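/- Let $U$ be a positive energy representation of $\mathrm{Diff}^+(S^1)$ on a complex Hilbert space $\mathcal H$: a strongly continuous projective unitary representation of the group of orientation preserving smooth diffeomorphisms of the circle (with its $C^\infty$ topology) for which the self-adjoint generator of the rotations is bounded from below. Let $\{L_n : n\in\mathbb Z\}$ be the associated representation of the Virasoro algebra, with central charge $c$. That is: the $L_n$ are linear operators on the common invariant dense domain $\mathcal D_{fin}$ of finite energy vectors (the algebraic span of the eigenvectors of the self-adjoint conformal Hamiltonian, the closure of $L_0$, which is denoted by $L_0$ too); $[L_n,L_m]=(n-m)L_{n+m}+\frac{c}{12}(n^3-n)\delta_{n,-m}\mathbb 1$, $L_n^*\supset L_{-n}$ and $L_0\ge 0$; and for every $n\ge 1$, $a\in\mathbb R$, $b\in\mathbb C$, with $f(z)=a+bz^n+\bar b z^{-n}$ (regarded as the vector field $f(e^{i\theta})\frac{d}{d\theta}$) one has $e^{it\,\overline{(aL_0+bL_n+\bar bL_{-n})}}=U(\mathrm{Exp}(tf))$ up to phases for all $t\in\mathbb R$, where $t\mapsto \mathrm{Exp}(tf)$ is the flow of $f$. (1) Let $a_n\in\mathbb C$ $(n\in\mathbb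 Z)$ satisfy $\sum_{n}|a_n||n|^{3/2}<\infty$. Then the series $A=\sum_n a_nL_n$ and $A^+=\sum_n\overline{a_{-n}}L_n$ converge strongly on $\mathcal D_{fin}$; as operators with domain $\mathcal D_{fin}$, $A$ is closable and $\overline A=(A^+)^*$. In particular, if $a_n=\overline{a_{-n}}$ for all $n$, then $A$ is essentially self-adjoint on $\mathcal D_{fin}$. (2) For $f\in C(S^1,\mathbb R)$ put $\hat f_n=\frac1{2\pi}\int_0^{2\pi}f(e^{i\theta})e^{-in\theta}\,d\theta$ and $\|f\|_{3/2}=\sum_n|\hat f_n|(1+|n|^{3/2})\in[0,\infty]$. If $\|f\|_{3/2}<\infty$, then $\sum_n\hat f_nL_n$ converges on $\mathcal D_{fin}$ and is essentially self-adjoint there; its closure $T(f)$ is defined on the domain of the self-adjoint operator $L_0$, and for every $v\in\mathcal D(L_0)$ $$\|T(f)v\|\le\sqrt{1+\tfrac{c}{12}}\;\|f\|_{3/2}\;\|(\mathbb 1+L_0)v\|.$$ (3) If $f,f_k\in C(S^1,\mathbb R)$ $(k\in\mathbb N)$ have finite $\|\cdot\|_{3/2}$ norm and $\|f_k-f\|_{3/2}\to0$,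 then $T(f_k)\to T(f)$ in the strong resolvent sense; in particular $e^{iT(f_k)}\to e^{iT(f)}$ strongly. -/

import Mathlib

open scoped InnerProductSpace LinearPMap ENNReal ComplexConjugate Topology

noncomputable section

/-! ### The group of orientation preserving diffeomorphisms of the circle -/

/-- `φ` is a smooth lift of `γ` to the angle coordinate, with positive derivative. -/
def IsPositiveLift (γ : Circle → Circle) (φ : ℝ → ℝ) : Prop :=
  ContDiff ℝ (⊤ : ℕ∞) φ ∧ (∀ θ, 0 < deriv φ θ) ∧ ∀ θ, γ (Circle.exp θ) = Circle.exp (φ θ)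

theorem IsPositiveLift.comp {γ δ : Circle → Circle} {φ ψ : ℝ → ℝ}
    (h : IsPositiveLift γ φ) (k : IsPositiveLift δ ψ) : IsPositiveLift (γ ∘ δ) (φ ∘ ψ) := by
  refine ⟨h.1.comp k.1, fun θ => ?_, fun θ => by simp [k.2.2, h.2.2]⟩
  have h1 : DifferentiableAt ℝ φ (ψ θ) := (h.1.differentiable (by simp)).differentiableAt
  have k1 : DifferentiableAt ℝ ψ θ := (k.1.differentiable (by simp)).differentiableAt
  rw [deriv_comp θ h1 k1]
  exact mul_pos (h.2.1 _) (k.2.1 _)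

/-- The group of orientation preserving smooth diffeomorphisms of the circle: the permutations
`γ` of the circle such that `γ` and its inverse have smooth strictly increasing lifts. -/
def DiffPlus : Subgroup (Equiv.Perm Circle) where
  carrier := {γ | (∃ φ, IsPositiveLift γ φ) ∧ ∃ φ, IsPositiveLift (γ⁻¹ : Equiv.Perm Circle) φ}
  one_mem' := by
    have h : IsPositiveLift (1 : Equiv.Perm Circle) id :=
      ⟨contDiff_id, fun θ => by simp, fun θ => by simp⟩
    exact ⟨⟨id, h⟩, ⟨id, by simpa using h⟩⟩
  mul_mem' := by
    rintro γ δ ⟨⟨φ, hφ⟩, ⟨φ', hφ'⟩⟩ ⟨⟨ψ, hψ⟩, ⟨ψ', hψ'⟩⟩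
    refine ⟨⟨φ ∘ ψ, ?_⟩, ⟨ψ' ∘ φ', ?_⟩⟩
    · rw [Equiv.Perm.coe_mul]
      exact hφ.comp hψ
    · rw [mul_inv_rev, Equiv.Perm.coe_mul]
      exact hψ'.comp hφ'
  inv_mem' := by
    rintro γ ⟨h, h'⟩
    exact ⟨h', by simpa using h⟩

/-- The `C^∞` topology: uniform convergence of the functions `θ ↦ γ (e^{iθ})` together with all
their derivatives. -/
abbrev DiffPlus.smoothTopology : TopologicalSpace DiffPlus :=
  ⨅ k : ℕ, TopologicalSpace.induced
    (fun γ : DiffPlus =>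
      UniformFun.ofFun (iteratedDeriv k (fun θ : ℝ => (γ.1 (Circle.exp θ) : ℂ))))
    inferInstance

/-- `t ↦ γ t` is the flow `t ↦ Exp (t f)` of the vector field `f(e^{iθ}) d/dθ`. -/
def IsFlow (f : C(Circle, ℝ)) (γ : ℝ → DiffPlus) : Prop :=
  γ 0 = 1 ∧ ∀ (t : ℝ) (z : Circle),
    HasDerivAt (fun s => ((γ s).1 z : ℂ))
      (Complex.I * (f ((γ t).1 z) : ℂ) * ((γ t).1 z : ℂ)) t

/-! ### Fourier coefficients and the `3/2`-norm -/

/-- The Fourier coefficients of a real continuous function on the circle. -/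
def circleCoeff (f : C(Circle, ℝ)) (n : ℤ) : ℂ :=
  (1 / (2 * Real.pi) : ℂ) *
    ∫ θ in (0 : ℝ)..(2 * Real.pi), (f (Circle.exp θ) : ℂ) * Complex.exp (-(Complex.I * n * θ))

/-- `‖f‖_{3/2} = ∑ₙ |f̂ₙ| (1 + |n|^{3/2})`, possibly infinite. -/
def norm32 (f : C(Circle, ℝ)) : ℝ≥0∞ :=
  ∑' n : ℤ, ENNReal.ofReal (‖circleCoeff f n‖ * (1 + |(n : ℝ)| ^ (3 / 2 : ℝ)))

section Hilbert

variable {H : Type*} [NormedAddCommGroup H] [InnerProductSpace ℂ H]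

/-! ### Unbounded operators -/

/-- `A` is the self-adjoint generator of the strongly continuous one-parameter group of unitaries
`W`, that is `W t = e^{itA}`: `v` is in the domain of `A` if and only if `t ↦ W t v` is
differentiable at `0`, and then `A v` is `-i` times the derivative. -/
structure IsUnitaryGroup (W : ℝ → H ≃ₗᵢ[ℂ] H) (A : H →ₗ.[ℂ] H) : Prop where
  map_zero : W 0 = 1
  map_add : ∀ s t, W (s + t) = W s * W t
  continuous : ∀ v, Continuous fun t => W t v
  generator : ∀ v w, (v, w) ∈ A.graph ↔ HasDerivAt (fun t => W t v) (Complex.I • w) 0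

/-- The (algebraic) span of the eigenvectors of `A`. -/
def eigenvectorSpan (A : H →ₗ.[ℂ] H) : Submodule ℂ H :=
  Submodule.span ℂ {v | ∃ q : ℂ, (v, q • v) ∈ A.graph}

/-- `A` is essentially self-adjoint on its domain. -/
def IsEssentiallySelfAdjoint [CompleteSpace H] (A : H →ₗ.[ℂ] H) : Prop :=
  Dense (A.domain : Set H) ∧ A.IsClosable ∧ IsSelfAdjoint A.closure

/-- The bounded operator `R` is the resolvent `(A - z)⁻¹`. -/
def IsResolventAt (A : H →ₗ.[ℂ] H) (z : ℂ) (R : H →L[ℂ] H) : Prop :=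
  (∀ v, (R v, v + z • R v) ∈ A.graph) ∧ ∀ x : A.domain, R (A x - z • (x : H)) = x

/-- Convergence in the strong resolvent sense: at every nonreal `z` the resolvents exist and
converge strongly. -/
def StrongResolventTendsto (A : ℕ → H →ₗ.[ℂ] H) (B : H →ₗ.[ℂ] H) : Prop :=
  ∀ z : ℂ, z.im ≠ 0 → ∃ (R : ℕ → H →L[ℂ] H) (S : H →L[ℂ] H),
    (∀ k, IsResolventAt (A k) z (R k)) ∧ IsResolventAt B z S ∧
      ∀ v, Filter.Tendsto (fun k => R k v) Filter.atTop (𝓝 (S v))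

/-! ### Projective unitary representations of the diffeomorphism group -/

variable (H) in
/-- The unitary operators that are multiples of the identity by a phase. -/
def phases : Subgroup (H ≃ₗᵢ[ℂ] H) where
  carrier := {u | ∃ z : Circle, ∀ v, u v = (z : ℂ) • v}
  one_mem' := ⟨1, fun v => by simp⟩
  mul_mem' := by
    rintro u w ⟨a, ha⟩ ⟨b, hb⟩
    exact ⟨a * b, fun v => by simp [ha, hb, mul_smul]⟩
  inv_mem' := by
    rintro u ⟨a, ha⟩
    refine ⟨a⁻¹, fun v => u.injective ?_⟩
    have h1 : u ((u⁻¹ : H ≃ₗᵢ[ℂ] H) v) = v := u.apply_symm_apply v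
    rw [h1, map_smul, ha v, smul_smul, Circle.coe_inv, inv_mul_cancel₀ a.coe_ne_zero, one_smul]

instance phases_normal : (phases H).Normal where
  conj_mem := by
    rintro u ⟨a, ha⟩ w
    refine ⟨a, fun v => ?_⟩
    simp only [LinearIsometryEquiv.coe_mul, Function.comp_apply, ha, map_smul]
    congr 1
    exact w.apply_symm_apply v

variable (H) in
/-- The projective unitary group of `H`. -/
abbrev ProjUnitary : Type _ := (H ≃ₗᵢ[ℂ] H) ⧸ phases H

variable (H) in
/-- The topology on the projective unitary group induced by the strong operator topology on the
unitary group. -/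
abbrev projTopology : TopologicalSpace (ProjUnitary H) :=
  TopologicalSpace.coinduced (fun u : H ≃ₗᵢ[ℂ] H => (u : ProjUnitary H))
    (TopologicalSpace.induced (fun (u : H ≃ₗᵢ[ℂ] H) (v : H) => u v) inferInstance)

/-- `A` is a self-adjoint generator, in the projective sense, of the one-parameter group of
projective unitaries `t ↦ U (γ t)`. -/
def IsProjGenerator (U : DiffPlus →* ProjUnitary H) (γ : ℝ → DiffPlus) (A : H →ₗ.[ℂ] H) : Prop :=
  ∃ W : ℝ → H ≃ₗᵢ[ℂ] H, IsUnitaryGroup W A ∧ ∀ t, (W t : ProjUnitary H) = U (γ t)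

/-- Positive energy representations of the diffeomorphism group: strongly continuous projective
unitary representations for which the generator of the rotations (the flow of the constant vector
field `1`) is bounded from below. -/
structure IsPositiveEnergy (U : DiffPlus →* ProjUnitary H) : Prop where
  continuous : Continuous[DiffPlus.smoothTopology, projTopology H] U
  bounded_below : ∃ (γ : ℝ → DiffPlus) (A : H →ₗ.[ℂ] H), IsFlow 1 γ ∧ IsProjGenerator U γ A ∧
    ∃ C : ℝ, ∀ x : A.domain, C * ‖(x : H)‖ ^ 2 ≤ (⟪(x : H), A x⟫_ℂ).re

/-! ### Representations of the Virasoro algebra -/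

variable (H) in
/-- A positive energy unitary representation of the Virasoro algebra with central charge `c`, on
an invariant dense domain. -/
structure VirasoroRep where
  domain : Submodule ℂ H
  dense_domain : Dense (domain : Set H)
  c : ℝ
  L : ℤ → Module.End ℂ domain
  commutator : ∀ n m : ℤ, ⁅L n, L m⁆ =
    ((n - m : ℤ) : ℂ) • L (n + m) +
      (if n = -m then ((c / 12 * ((n : ℝ) ^ 3 - n) : ℝ) : ℂ) else 0) • (1 : Module.End ℂ domain)
  unitary : ∀ (n : ℤ) (x y : domain), ⟪(L n x : H), (y : H)⟫_ℂ = ⟪(x : H), (L (-n) y : H)⟫_ℂ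
  nonneg : ∀ x : domain, 0 ≤ (⟪(x : H), (L 0 x : H)⟫_ℂ).re
  diagonalizable : ⨆ q : ℂ, (L 0).eigenspace q = ⊤

namespace VirasoroRep

variable (V : VirasoroRep H)

theorem series_add (a : ℤ → ℂ) (v w : H) (hv : v ∈ V.domain) (hw : w ∈ V.domain) (n : ℤ) :
    a n • (V.L n ⟨v + w, V.domain.add_mem hv hw⟩ : H) =
      a n • (V.L n ⟨v, hv⟩ : H) + a n • (V.L n ⟨w, hw⟩ : H) := by
  rw [← smul_add, ← Submodule.coe_add, ← map_add]
  rfl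

theorem series_smul (a : ℤ → ℂ) (q : ℂ) (v : H) (hv : v ∈ V.domain) (n : ℤ) :
    a n • (V.L n ⟨q • v, V.domain.smul_mem q hv⟩ : H) = q • a n • (V.L n ⟨v, hv⟩ : H) := by
  have h : V.L n ⟨q • v, V.domain.smul_mem q hv⟩ = q • V.L n ⟨v, hv⟩ := map_smul (V.L n) q ⟨v, hv⟩
  rw [h, Submodule.coe_smul, smul_comm]

/-- The operator `∑ₙ aₙ Lₙ`, defined at those vectors of the domain of the representation at
which the series converges (unconditionally, in norm). -/
def series (a : ℤ → ℂ) : H →ₗ.[ℂ] H where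
  domain :=
    { carrier := {v | ∃ h : v ∈ V.domain, Summable fun n => a n • (V.L n ⟨v, h⟩ : H)}
      zero_mem' := ⟨V.domain.zero_mem, summable_zero.congr fun n => by
        have h0 : (⟨0, V.domain.zero_mem⟩ : V.domain) = 0 := rfl
        rw [h0, map_zero, Submodule.coe_zero, smul_zero]⟩
      add_mem' := by
        rintro v w ⟨hv, sv⟩ ⟨hw, sw⟩
        exact ⟨V.domain.add_mem hv hw, (sv.add sw).congr fun n => (series_add V a v w hv hw n).symm⟩
      smul_mem' := by
        rintro q v ⟨hv, sv⟩
        exact ⟨V.domain.smul_mem q hv, (sv.const_smul q).congr fun n => (series_smul V a q v hv n).symm⟩ }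
  toFun :=
    { toFun := fun v => ∑' n, a n • (V.L n ⟨v, v.2.fst⟩ : H)
      map_add' := by
        rintro ⟨v, hv, sv⟩ ⟨w, hw, sw⟩
        exact (tsum_congr fun n => series_add V a v w hv hw n).trans (sv.tsum_add sw)
      map_smul' := by
        rintro q ⟨v, hv, sv⟩
        exact (tsum_congr fun n => series_smul V a q v hv n).trans (sv.tsum_const_smul q) }

/-- The conformal Hamiltonian: the closure of `L₀`. -/
def hamiltonian : H →ₗ.[ℂ] H :=
  (V.series (Pi.single 0 1)).closure

/-- The stress-energy tensor `T(f)`: the closure of `∑ₙ f̂ₙ Lₙ`. -/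
def stressTensor (f : C(Circle, ℝ)) : H →ₗ.[ℂ] H :=
  (V.series (circleCoeff f)).closure

/-- `V` is the representation of the Virasoro algebra associated to `U`: its domain is the set of
finite energy vectors (the span of the eigenvectors of the self-adjoint conformal Hamiltonian), and
for the real vector fields `f(z) = a + b zⁿ + b̄ z⁻ⁿ`, which form the Lie algebra of the `n`-fold
covering of the Möbius group, `e^{itT(f)} = U(Exp(tf))` in the projective sense. -/
structure IsAssociatedTo (U : DiffPlus →* ProjUnitary H) : Prop where
  domain_eq : V.domain = eigenvectorSpan V.hamiltonian
  generator : ∀ (n : ℕ), 0 < n → ∀ (a : ℝ) (b : ℂ) (f : C(Circle, ℝ)),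
    (∀ z : Circle, f z = a + 2 * (b * (z : ℂ) ^ n).re) →
      ∃ γ : ℝ → DiffPlus, IsFlow f γ ∧ IsProjGenerator U γ (V.stressTensor f)

end VirasoroRep

end Hilbert

end

/-! Two estimates at vectors of fixed energy carry the theorem. `L₀` is symmetric, nonnegative and
diagonalizable, so its eigenspaces are orthogonal, and `Lₙ` lowers the energy by `n`; by Pythagoras,
homogeneous operators can be compared one eigenvector at a time (`norm_le_of_homogeneous`).

The first estimate is the energy bound `norm_L_le`. The commutator of `Lₙ` with `L₋ₙ` and an
induction on the energy control `‖Lₙ x‖²`; the central term contributes growth `n³` to the square,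
whence the exponent `3/2`. This yields convergence of the series on the finite energy vectors,
boundedness relative to `L₀`, and continuity in the `3/2`-norm.

The second estimate is `norm_commutator_cutoff_le`. For the cutoffs `Mₖ = φₖ(L₀)` with `φₖ`
piecewise linear of slope `-1/(k+1)`, the commutators `[Lₙ, Mₖ]` are bounded by a multiple of
`|n|^{3/2}` uniformly in `k`: the small slope compensates the growth of `Lₙ` at energies of order
`k`. Hence `[A, Mₖ]` is uniformly bounded and tends strongly to `0`. If `(y, z)` is in the graph of
`(A⁺)*`, then `A Mₖ y = Mₖ z + [A, Mₖ] y → z` while `Mₖ y → y`, so `(y, z)` is in the closure of the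
graph of `A` (`mem_closure_of_cutoffs`). The other inclusion is formal adjointness.

For the last part, the operators converge on a common core, which gives convergence of the
resolvents (`strongResolventTendsto_of_core`); a Duhamel interpolation passes from resolvents to
unitary groups (`StrongResolventTendsto.tendsto_unitary`). -/

noncomputable section

/-! ### Energy bounds for the Virasoro generators -/

namespace VirasoroRep

variable {H : Type*} [NormedAddCommGroup H] [InnerProductSpace ℂ H] (V : VirasoroRep H)

/-- The space of vectors of energy `q` in the domain of the representation. -/
abbrev energySpace (q : ℂ) : Submodule ℂ V.domain := (V.L 0).eigenspace q

theorem inner_L (n : ℤ) (x y : V.domain) : ⟪V.L n x, y⟫_ℂ = ⟪x, V.L (-n) y⟫_ℂ := V.unitary n x y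

theorem inner_L_zero (x y : V.domain) : ⟪V.L 0 x, y⟫_ℂ = ⟪x, V.L 0 y⟫_ℂ := by
  simpa using V.inner_L 0 x y

variable {V} in
theorem L_zero_apply {q : ℂ} {x : V.domain} (hx : x ∈ V.energySpace q) : V.L 0 x = q • x :=
  Module.End.mem_eigenspace_iff.1 hx

variable {V} in
theorem energy_eq_ofReal {q : ℂ} {x : V.domain} (hx : x ∈ V.energySpace q) (h0 : x ≠ 0) :
    q = (q.re : ℂ) ∧ 0 ≤ q.re := by
  have h1 := V.inner_L_zero x x
  rw [L_zero_apply hx, inner_smul_left, inner_smul_right] at h1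
  have h2 : ⟪x, x⟫_ℂ ≠ 0 := inner_self_ne_zero.2 h0
  have h3 : q = (q.re : ℂ) := (Complex.conj_eq_iff_re.1 (mul_right_cancel₀ h2 h1)).symm
  refine ⟨h3, ?_⟩
  have h4 : 0 ≤ (⟪x, V.L 0 x⟫_ℂ).re := V.nonneg x
  rw [L_zero_apply hx, inner_smul_right, h3, inner_self_eq_norm_sq_to_K] at h4
  have h5 : 0 < ‖x‖ ^ 2 := by positivity
  have h6 : ((q.re : ℂ) * (RCLike.ofReal ‖x‖ : ℂ) ^ 2).re = q.re * ‖x‖ ^ 2 := by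
    rw [← RCLike.ofReal_pow]
    exact Complex.re_mul_ofReal _ _
  rw [h6] at h4
  exact nonneg_of_mul_nonneg_left h4 h5

theorem orthogonalFamily_energySpace :
    OrthogonalFamily ℂ (fun q => V.energySpace q) fun q => (V.energySpace q).subtypeₗᵢ := by
  rintro p q hpq ⟨x, hx⟩ ⟨y, hy⟩
  change ⟪x, y⟫_ℂ = 0
  by_cases h0 : x = 0
  · simp [h0]
  have h1 := V.inner_L_zero x y
  rw [L_zero_apply hx, L_zero_apply hy, inner_smul_left, inner_smul_right,
    (energy_eq_ofReal hx h0).1, Complex.conj_ofReal, ← (energy_eq_ofReal hx h0).1] at h1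
  exact (mul_eq_mul_right_iff.1 h1).resolve_left hpq

theorem L_mem_energySpace (n : ℤ) {q : ℂ} {x : V.domain} (hx : x ∈ V.energySpace q) :
    V.L n x ∈ V.energySpace (q - n) := by
  have h1 := LinearMap.congr_fun (V.commutator n 0) x
  have h2 : (if n = -0 then ((V.c / 12 * ((n : ℝ) ^ 3 - n) : ℝ) : ℂ) else 0) = 0 := by
    split_ifs with h
    · simp [h]
    · rfl
  rw [h2, Ring.lie_def] at h1
  simp only [LinearMap.sub_apply, Module.End.mul_apply, L_zero_apply hx, map_smul, zero_smul,
    add_zero, sub_zero, LinearMap.smul_apply] at h1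
  rw [Module.End.mem_eigenspace_iff, sub_smul, ← h1]
  abel

theorem energySpace_induction {p : V.domain → Prop} (mem : ∀ q, ∀ x ∈ V.energySpace q, p x)
    (zero : p 0) (add : ∀ x y, p x → p y → p (x + y)) (x : V.domain) : p x :=
  Submodule.iSup_induction (motive := p) _ (V.diagonalizable ▸ Submodule.mem_top : x ∈ ⨆ q, V.energySpace q)
    mem zero add

/-- A homogeneous operator is dominated by another one as soon as it is so at vectors of
fixed energy. -/
theorem norm_le_of_homogeneous {T S : Module.End ℂ V.domain} {s : ℂ} {K : ℝ} (hK : 0 ≤ K)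
    (hT : ∀ q, ∀ x ∈ V.energySpace q, T x ∈ V.energySpace (q - s))
    (hS : ∀ q, ∀ x ∈ V.energySpace q, S x ∈ V.energySpace q)
    (hTS : ∀ q, ∀ x ∈ V.energySpace q, ‖T x‖ ≤ K * ‖S x‖) (x : V.domain) :
    ‖T x‖ ≤ K * ‖S x‖ := by
  have hx : x ∈ ⨆ q, V.energySpace q := V.diagonalizable ▸ Submodule.mem_top
  obtain ⟨f, hf⟩ := (Submodule.mem_iSup_iff_exists_finsupp _ _).1 hx
  obtain ⟨hf, rfl⟩ := hf
  -- The shift `q ↦ q - s` is injective, so the images of the components are again pairwise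
  -- orthogonal.
  have h1 : ‖T (f.sum fun _ y => y)‖ ^ 2 = ∑ q ∈ f.support, ‖T (f q)‖ ^ 2 := by
    rw [Finsupp.sum, map_sum]
    exact (V.orthogonalFamily_energySpace.comp (sub_left_injective (b := s))).norm_sum
      (fun q => ⟨T (f q), hT q _ (hf q)⟩) f.support
  have h2 : ‖S (f.sum fun _ y => y)‖ ^ 2 = ∑ q ∈ f.support, ‖S (f q)‖ ^ 2 := by
    rw [Finsupp.sum, map_sum]
    exact V.orthogonalFamily_energySpace.norm_sum (fun q => ⟨S (f q), hS q _ (hf q)⟩) f.support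
  refine le_of_sq_le_sq ?_ (by positivity)
  rw [mul_pow, h1, h2, Finset.mul_sum]
  refine Finset.sum_le_sum fun q _ => ?_
  rw [← mul_pow]
  exact pow_le_pow_left₀ (norm_nonneg _) (hTS q _ (hf q)) 2

/-- This is the expectation of `[Lₙ, L₋ₙ] = 2n L₀ + c/12 (n³ - n)` at `x`, the two products being
squared norms by unitarity. -/
theorem norm_sq_L_neg (n : ℤ) {h : ℝ} {x : V.domain} (hx : x ∈ V.energySpace h) :
    ‖V.L (-n) x‖ ^ 2 =
      ‖V.L n x‖ ^ 2 + (2 * n * h + V.c / 12 * ((n : ℝ) ^ 3 - n)) * ‖x‖ ^ 2 := by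
  have h1 := LinearMap.congr_fun (V.commutator n (-n)) x
  have h2 : ⟪x, V.L n (V.L (-n) x)⟫_ℂ = (‖V.L (-n) x‖ ^ 2 : ℝ) := by
    have := V.inner_L (-n) x (V.L (-n) x)
    rw [neg_neg] at this
    rw [← this, inner_self_eq_norm_sq_to_K]
    simp
  have h3 : ⟪x, V.L (-n) (V.L n x)⟫_ℂ = (‖V.L n x‖ ^ 2 : ℝ) := by
    rw [← V.inner_L n x (V.L n x), inner_self_eq_norm_sq_to_K]
    simp
  have h4 : ⟪x, x⟫_ℂ = (‖x‖ ^ 2 : ℝ) := by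
    rw [inner_self_eq_norm_sq_to_K]
    simp
  rw [neg_neg, if_pos rfl, add_neg_cancel, Ring.lie_def] at h1
  simp only [LinearMap.sub_apply, Module.End.mul_apply, LinearMap.add_apply, LinearMap.smul_apply,
    Module.End.one_apply, L_zero_apply hx] at h1
  have h5 := congrArg (fun y => ⟪x, y⟫_ℂ) h1
  simp only [inner_sub_right, inner_add_right, inner_smul_right, h2, h3, h4] at h5
  have h6 : ((‖V.L (-n) x‖ ^ 2 : ℝ) : ℂ) = ((‖V.L n x‖ ^ 2 +
      (2 * n * h + V.c / 12 * ((n : ℝ) ^ 3 - n)) * ‖x‖ ^ 2 : ℝ) : ℂ) := by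
    rw [sub_eq_iff_eq_add.1 h5]
    push_cast
    ring
  exact_mod_cast h6

theorem L_eq_zero (n : ℤ) {h : ℝ} (hn : h < n) {x : V.domain} (hx : x ∈ V.energySpace h) :
    V.L n x = 0 := by
  by_contra h0
  have h1 := (energy_eq_ofReal (V.L_mem_energySpace n hx) h0).2
  simp only [Complex.sub_re, Complex.ofReal_re, Complex.intCast_re] at h1
  linarith

/-- For `n > h` the vector `Lₙ x` vanishes, so `2nh + c/12 (n³ - n)` is a ratio of squared norms; a
negative `c` would make it negative for large `n`. -/
theorem c_nonneg {h : ℝ} {x : V.domain} (hx : x ∈ V.energySpace h) (h0 : x ≠ 0) : 0 ≤ V.c := by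
  by_contra! hc
  have hh : 0 ≤ h := by simpa using (energy_eq_ofReal hx h0).2
  obtain ⟨n, hn⟩ := exists_nat_gt (max (max h 2) (24 * h / (-V.c) + 1))
  have n1 : h < n := (le_max_left _ _).trans_lt ((le_max_left _ _).trans_lt hn)
  have n2 : 2 < (n : ℝ) := (le_max_right _ _).trans_lt ((le_max_left _ _).trans_lt hn)
  have n3 : 24 * h / (-V.c) + 1 < (n : ℝ) := (le_max_right _ _).trans_lt hn
  have h1 := V.norm_sq_L_neg n hx
  rw [V.L_eq_zero n (by simpa using n1) hx] at h1
  simp only [norm_zero, Int.cast_natCast] at h1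
  have h2 : 0 < ‖x‖ ^ 2 := by positivity
  have h3 : 0 ≤ 2 * n * h + V.c / 12 * ((n : ℝ) ^ 3 - n) := by
    refine nonneg_of_mul_nonneg_left ?_ h2
    have : 0 ≤ ‖V.L (-(n : ℤ)) x‖ ^ 2 := by positivity
    linarith
  have h4 : 24 * h < (n - 1) * (-V.c) := by
    rw [← div_lt_iff₀ (by linarith)]
    linarith
  have h5 : 0 ≤ (n : ℝ) * (24 * h - (-V.c) * (n - 1) * (n + 1)) := by nlinarith
  have h6 := nonneg_of_mul_nonneg_right h5 (by linarith)
  nlinarith [mul_pos (by linarith : (0 : ℝ) < (n - 1) * (-V.c)) (by linarith : (0 : ℝ) < n)]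

/-- Induction on the energy in steps of `n`, with `k` counting the steps. For `w = Lₙ x`, of energy
`h - n`, the inductive bound on `Lₙ w` gives a bound on `L₋ₙ w`, and `‖w‖² = ⟪x, L₋ₙ w⟫ ≤ ‖x‖ ‖L₋ₙ
w‖` carries it back to `x`. -/
theorem norm_sq_L_le_of_pos {n : ℕ} (hn : 0 < n) (hc : 0 ≤ V.c) (k : ℕ) {h : ℝ} (hk : h < k * n)
    {x : V.domain} (hx : x ∈ V.energySpace h) :
    ‖V.L n x‖ ^ 2 ≤ (h ^ 2 + h * n ^ 2 * (V.c / 12)) * ‖x‖ ^ 2 := by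
  induction k generalizing h x with
  | zero =>
    by_cases h0 : x = 0
    · simp [h0]
    · have := (energy_eq_ofReal hx h0).2
      simp only [Complex.ofReal_re] at this
      simp at hk
      linarith
  | succ k ih =>
    by_cases h0 : x = 0
    · simp [h0]
    have hh : 0 ≤ h := by simpa using (energy_eq_ofReal hx h0).2
    by_cases hhn : h < n
    · rw [V.L_eq_zero n (by simpa using hhn) hx]
      rw [norm_zero, zero_pow two_ne_zero]
      positivity
    push Not at hhn
    have hn1 : (1 : ℝ) ≤ n := by exact_mod_cast hn
    set w := V.L n x with hw
    have hw1 : w ∈ V.energySpace ((h - n : ℝ) : ℂ) := by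
      simpa using V.L_mem_energySpace n hx
    have h1 := ih (by push_cast at hk; linarith) hw1
    have h2 := V.norm_sq_L_neg n hw1
    have h3 : ‖w‖ ^ 2 ≤ ‖x‖ * ‖V.L (-n) w‖ := by
      have e : ⟪w, w⟫_ℂ = ⟪x, V.L (-n) w⟫_ℂ := V.inner_L n x w
      have := norm_inner_le_norm (𝕜 := ℂ) x (V.L (-n) w)
      rw [← e, inner_self_eq_norm_sq_to_K] at this
      simpa using this
    -- The bound reproduces itself: `(h-n)² + 2n(h-n) = h² - n²` and `(h-n)n² + n³ - n = hn² - n`.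
    have h4 : ‖V.L (-n) w‖ ^ 2 ≤ (h ^ 2 + h * n ^ 2 * (V.c / 12)) * ‖w‖ ^ 2 := by
      rw [h2]
      refine (add_le_add_left h1 _).trans ?_
      rw [← add_mul]
      refine mul_le_mul_of_nonneg_right ?_ (by positivity)
      push_cast
      nlinarith [mul_nonneg hc (by linarith : (0 : ℝ) ≤ n)]
    by_cases hw0 : ‖w‖ ^ 2 = 0
    · rw [hw0]
      positivity
    have h5 : 0 < ‖w‖ ^ 2 := lt_of_le_of_ne (by positivity) (Ne.symm hw0)
    have h6 : ‖w‖ ^ 2 * ‖w‖ ^ 2 ≤ ((h ^ 2 + h * n ^ 2 * (V.c / 12)) * ‖x‖ ^ 2) * ‖w‖ ^ 2 := by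
      calc ‖w‖ ^ 2 * ‖w‖ ^ 2 ≤ (‖x‖ * ‖V.L (-n) w‖) * (‖x‖ * ‖V.L (-n) w‖) := by gcongr
        _ = ‖x‖ ^ 2 * ‖V.L (-n) w‖ ^ 2 := by ring
        _ ≤ ‖x‖ ^ 2 * ((h ^ 2 + h * n ^ 2 * (V.c / 12)) * ‖w‖ ^ 2) := by gcongr
        _ = _ := by ring
    exact le_of_mul_le_mul_right h6 h5

/-- The norm of `Lₙ` at vectors of energy `h`, in terms of the larger one of the energies `h` and
`h - n`. -/
theorem norm_sq_L_le (n : ℤ) {h : ℝ} {x : V.domain} (hx : x ∈ V.energySpace h) :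
    ‖V.L n x‖ ^ 2 ≤
      (max h (h - n) ^ 2 + max h (h - n) * n ^ 2 * (V.c / 12)) * ‖x‖ ^ 2 := by
  by_cases h0 : x = 0
  · simp [h0]
  have hh : 0 ≤ h := by simpa using (energy_eq_ofReal hx h0).2
  have hc := V.c_nonneg hx h0
  have key : ∀ m : ℕ, 0 < m → ‖V.L m x‖ ^ 2 ≤ (h ^ 2 + h * m ^ 2 * (V.c / 12)) * ‖x‖ ^ 2 := by
    intro m hm
    obtain ⟨k, hk⟩ := exists_nat_gt h
    refine V.norm_sq_L_le_of_pos hm hc k (hk.trans_le ?_) hx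
    exact le_mul_of_one_le_right (by positivity) (by exact_mod_cast hm)
  rcases lt_trichotomy n 0 with hn | rfl | hn
  -- Raising operators reduce to lowering ones through the commutator: `h² + 2mh ≤ (h+m)²` and `hm²
  -- + m³ - m ≤ (h+m)m²`.
  · obtain ⟨m, rfl⟩ : ∃ m : ℕ, n = -m := ⟨n.natAbs, by omega⟩
    have hm : 0 < m := by omega
    have hm1 : (1 : ℝ) ≤ m := by exact_mod_cast hm
    rw [max_eq_right (by push_cast; linarith), V.norm_sq_L_neg m hx]
    refine (add_le_add_left (key m hm) _).trans ?_
    rw [← add_mul]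
    refine mul_le_mul_of_nonneg_right ?_ (by positivity)
    push_cast
    nlinarith [mul_nonneg hc (by linarith : (0 : ℝ) ≤ m), sq_nonneg (m : ℝ)]
  · rw [L_zero_apply hx, norm_smul, mul_pow]
    simp
  · obtain ⟨m, rfl⟩ : ∃ m : ℕ, n = m := ⟨n.natAbs, by omega⟩
    have hm : 0 < m := by omega
    rw [max_eq_left (by simp)]
    simpa using key m hm

theorem abs_rpow_sq (n : ℤ) :
    (|(n : ℝ)| ^ (3 / 2 : ℝ)) ^ 2 = |(n : ℝ)| ^ 3 := by
  rw [← Real.rpow_natCast, ← Real.rpow_mul (abs_nonneg _), ← Real.rpow_natCast]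
  norm_num

theorem abs_le_rpow (n : ℤ) : |(n : ℝ)| ≤ |(n : ℝ)| ^ (3 / 2 : ℝ) := by
  by_cases h : n = 0
  · simp [h]
  · have h1 : (1 : ℝ) ≤ |(n : ℝ)| := by exact_mod_cast Int.one_le_abs h
    simpa using Real.rpow_le_rpow_of_exponent_le h1 (by norm_num : (1 : ℝ) ≤ 3 / 2)

/-- The energy bounds for the Virasoro generators. -/
theorem norm_L_le (n : ℤ) (x : V.domain) :
    ‖V.L n x‖ ≤ Real.sqrt (1 + V.c / 12) * (1 + |(n : ℝ)| ^ (3 / 2 : ℝ)) * ‖x + V.L 0 x‖ := by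
  refine V.norm_le_of_homogeneous (T := V.L n) (S := 1 + V.L 0) (s := n) (by positivity)
    (fun q x hx => V.L_mem_energySpace n hx) (fun q x hx => ?_) (fun q x hx => ?_) x
  · rw [LinearMap.add_apply, L_zero_apply hx]
    exact Submodule.add_mem _ hx (Submodule.smul_mem _ _ hx)
  by_cases h0 : x = 0
  · simp [h0]
  obtain ⟨h1, hh⟩ := energy_eq_ofReal hx h0
  obtain ⟨h, rfl⟩ : ∃ h : ℝ, q = h := ⟨_, h1⟩
  rw [Complex.ofReal_re] at hh
  have hc := V.c_nonneg hx h0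
  have h2 : ‖(1 + V.L 0) x‖ = (1 + h) * ‖x‖ := by
    have : (1 + V.L 0) x = ((1 + h : ℝ) : ℂ) • x := by
      simp [LinearMap.add_apply, L_zero_apply hx, add_smul]
    rw [this, norm_smul, Complex.norm_real, Real.norm_of_nonneg (by positivity)]
  refine le_of_sq_le_sq ((V.norm_sq_L_le n hx).trans ?_) (by positivity)
  rw [h2, mul_pow, mul_pow, mul_pow, Real.sq_sqrt (by positivity), ← mul_assoc]
  refine mul_le_mul_of_nonneg_right ?_ (by positivity)
  set t := |(n : ℝ)| ^ (3 / 2 : ℝ) with ht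
  have t0 : 0 ≤ t := by positivity
  have t1 : |(n : ℝ)| ≤ t := abs_le_rpow n
  have t2 : t ^ 2 = |(n : ℝ)| ^ 3 := abs_rpow_sq n
  set m := |(n : ℝ)| with hm
  have m0 : 0 ≤ m := abs_nonneg _
  have hM0 : 0 ≤ max h (h - n) := le_max_of_le_left hh
  have hM : max h (h - n) ≤ h + m := max_le (by linarith) (by linarith [neg_le_abs (n : ℝ)])
  have e1 : max h (h - n) ^ 2 ≤ ((1 + t) * (1 + h)) ^ 2 := by
    refine pow_le_pow_left₀ hM0 (hM.trans ?_) 2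
    nlinarith
  -- The central contribution is where `3/2` is needed: `(h + m)m²` contains `m³ = t²`.
  have e2 : max h (h - n) * n ^ 2 ≤ ((1 + t) * (1 + h)) ^ 2 := by
    rw [← sq_abs (n : ℝ)]
    have m1 : m ^ 2 ≤ m ^ 3 := by
      by_cases h : n = 0
      · simp [hm, h]
      · have h1 : (1 : ℝ) ≤ m := by rw [hm]; exact_mod_cast Int.one_le_abs h
        exact pow_le_pow_right₀ h1 (by norm_num)
    calc max h (h - n) * m ^ 2 ≤ (h + m) * m ^ 2 := by gcongr
      _ = h * m ^ 2 + m ^ 3 := by ring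
      _ ≤ h * t ^ 2 + t ^ 2 := by rw [t2]; gcongr
      _ = t ^ 2 * (1 + h) := by ring
      _ ≤ (1 + t) ^ 2 * (1 + h) ^ 2 := by
        gcongr
        · linarith
        · nlinarith
      _ = _ := by ring
  nlinarith [mul_le_mul_of_nonneg_right e2 (by positivity : 0 ≤ V.c / 12)]

end VirasoroRep
end

noncomputable section

/-! ### Cutoffs in the energy -/

namespace VirasoroRep

variable {H : Type*} [NormedAddCommGroup H] [InnerProductSpace ℂ H] (V : VirasoroRep H)

open Classical in
theorem isInternal_energySpace : DirectSum.IsInternal fun q => V.energySpace q :=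
  DirectSum.isInternal_submodule_of_iSupIndep_of_iSup_eq_top (V.L 0).eigenspaces_iSupIndep
    V.diagonalizable

open Classical in
/-- The operator `φ(L₀)`. -/
def multiplier (φ : ℂ → ℂ) : Module.End ℂ V.domain :=
  DirectSum.coeLinearMap (fun q => V.energySpace q) ∘ₗ
    DirectSum.lmap (fun q => φ q • LinearMap.id) ∘ₗ
      (LinearEquiv.ofBijective (DirectSum.coeLinearMap fun q => V.energySpace q)
        V.isInternal_energySpace).symm

theorem multiplier_apply (φ : ℂ → ℂ) {q : ℂ} {x : V.domain} (hx : x ∈ V.energySpace q) :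
    V.multiplier φ x = φ q • x := by
  classical
  have h : (LinearEquiv.ofBijective (DirectSum.coeLinearMap fun q => V.energySpace q)
      V.isInternal_energySpace).symm x =
        DirectSum.lof ℂ ℂ (fun q => V.energySpace q) q ⟨x, hx⟩ :=
    (LinearEquiv.symm_apply_eq _).2
      (DirectSum.coeLinearMap_lof (fun q => V.energySpace q) q ⟨x, hx⟩).symm
  rw [multiplier, LinearMap.comp_apply, LinearMap.comp_apply, LinearEquiv.coe_coe, h,
    DirectSum.lmap_lof, DirectSum.coeLinearMap_lof]
  rfl

theorem multiplier_mem_energySpace (φ : ℂ → ℂ) {q : ℂ} {x : V.domain}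
    (hx : x ∈ V.energySpace q) : V.multiplier φ x ∈ V.energySpace q := by
  rw [V.multiplier_apply φ hx]
  exact Submodule.smul_mem _ _ hx

theorem inner_multiplier {φ : ℂ → ℂ} (hφ : ∀ q, conj (φ q) = φ q) (x y : V.domain) :
    ⟪V.multiplier φ x, y⟫_ℂ = ⟪x, V.multiplier φ y⟫_ℂ := by
  induction x using V.energySpace_induction with
  | zero => simp
  | add x x' hx hx' => simp [hx, hx']
  | mem p x hx =>
    induction y using V.energySpace_induction with
    | zero => simp
    | add y y' hy hy' => simp [hy, hy']
    | mem q y hy =>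
      rw [V.multiplier_apply φ hx, V.multiplier_apply φ hy, inner_smul_left, inner_smul_right, hφ]
      by_cases hpq : p = q
      · rw [hpq]
      · have h : ⟪x, y⟫_ℂ = 0 := V.orthogonalFamily_energySpace hpq ⟨x, hx⟩ ⟨y, hy⟩
        rw [h, mul_zero, mul_zero]

/-- The profile of the cutoff at energies of the order of `k`. -/
def cutoffProfile (k : ℕ) (h : ℝ) : ℝ := max 0 (1 - h / (k + 1))

/-- The cutoff of the energies of the order of `k`. -/
def cutoff (k : ℕ) : Module.End ℂ V.domain := V.multiplier fun q => (cutoffProfile k q.re : ℂ)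

theorem cutoff_apply (k : ℕ) {q : ℂ} {x : V.domain} (hx : x ∈ V.energySpace q) :
    V.cutoff k x = (cutoffProfile k q.re : ℂ) • x := V.multiplier_apply _ hx

theorem cutoff_mem_energySpace (k : ℕ) {q : ℂ} {x : V.domain} (hx : x ∈ V.energySpace q) :
    V.cutoff k x ∈ V.energySpace q := V.multiplier_mem_energySpace _ hx

theorem cutoffProfile_nonneg (k : ℕ) (h : ℝ) : 0 ≤ cutoffProfile k h := le_max_left _ _

theorem cutoffProfile_le_one (k : ℕ) {h : ℝ} (hh : 0 ≤ h) : cutoffProfile k h ≤ 1 := by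
  refine max_le zero_le_one ?_
  have : 0 ≤ h / (k + 1) := by positivity
  linarith

theorem cutoffProfile_eq_zero (k : ℕ) {h : ℝ} (hh : k + 1 ≤ h) : cutoffProfile k h = 0 := by
  refine max_eq_left ?_
  have : 1 ≤ h / (k + 1) := (one_le_div (by positivity : (0 : ℝ) < k + 1)).2 hh
  linarith

/-- The Lipschitz constant `1/(k+1)` is the reason for a sloping profile: a sharp cutoff would leave
commutators growing with `k`. -/
theorem abs_cutoffProfile_sub_le (k : ℕ) (g h : ℝ) :
    |cutoffProfile k g - cutoffProfile k h| ≤ |g - h| / (k + 1) := by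
  rw [cutoffProfile, cutoffProfile, max_comm 0, max_comm 0]
  refine (abs_max_sub_max_le_abs _ _ _).trans_eq ?_
  have : (1 - g / (k + 1) - (1 - h / (k + 1)) : ℝ) = -((g - h) / (k + 1)) := by ring
  rw [this, abs_neg, abs_div, abs_of_pos (by positivity : (0 : ℝ) < k + 1)]

theorem tendsto_cutoffProfile (h : ℝ) :
    Filter.Tendsto (fun k => cutoffProfile k h) Filter.atTop (𝓝 1) := by
  have h1 : Filter.Tendsto (fun k : ℕ => h / ((k : ℝ) + 1)) Filter.atTop (𝓝 0) := by
    have := (tendsto_one_div_add_atTop_nhds_zero_nat (𝕜 := ℝ)).const_mul h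
    simpa [div_eq_mul_inv] using this
  have h2 := (tendsto_const_nhds (x := (0 : ℝ))).max ((tendsto_const_nhds (x := (1 : ℝ))).sub h1)
  simpa [cutoffProfile] using h2

theorem inner_cutoff (k : ℕ) (x y : V.domain) : ⟪V.cutoff k x, y⟫_ℂ = ⟪x, V.cutoff k y⟫_ℂ :=
  V.inner_multiplier (fun _ => Complex.conj_ofReal _) x y

theorem norm_cutoff_le (k : ℕ) (x : V.domain) : ‖V.cutoff k x‖ ≤ ‖x‖ := by
  have := V.norm_le_of_homogeneous (T := V.cutoff k) (S := 1) (s := 0) zero_le_one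
    (fun q x hx => by rw [sub_zero]; exact V.cutoff_mem_energySpace k hx) (fun q x hx => hx)
    (fun q x hx => ?_) x
  · simpa using this
  by_cases h0 : x = 0
  · simp [h0]
  rw [V.cutoff_apply k hx, norm_smul, Complex.norm_real, Real.norm_of_nonneg
    (cutoffProfile_nonneg _ _)]
  exact mul_le_mul_of_nonneg_right (cutoffProfile_le_one k (energy_eq_ofReal hx h0).2)
    (norm_nonneg _)

theorem cutoff_L_zero (k : ℕ) (x : V.domain) : V.cutoff k (V.L 0 x) = V.L 0 (V.cutoff k x) := by
  induction x using V.energySpace_induction with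
  | zero => simp
  | add x y hx hy => simp [hx, hy]
  | mem q x hx =>
    rw [L_zero_apply hx, map_smul, L_zero_apply (V.cutoff_mem_energySpace k hx)]

/-- Only energies below `k + 1` survive the cutoff. Together with the energy bound this makes a
series of generators bounded after a cutoff. -/
theorem norm_cutoff_add_L_zero_le (k : ℕ) (x : V.domain) :
    ‖V.cutoff k x + V.L 0 (V.cutoff k x)‖ ≤ (k + 2) * ‖x‖ := by
  refine V.norm_le_of_homogeneous (T := V.cutoff k + V.L 0 * V.cutoff k) (S := 1) (s := 0)
    (by positivity) (fun q x hx => ?_) (fun q x hx => hx) (fun q x hx => ?_) x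
  · rw [sub_zero, LinearMap.add_apply, Module.End.mul_apply,
      L_zero_apply (V.cutoff_mem_energySpace k hx)]
    exact Submodule.add_mem _ (V.cutoff_mem_energySpace k hx)
      (Submodule.smul_mem _ _ (V.cutoff_mem_energySpace k hx))
  by_cases h0 : x = 0
  · simp [h0]
  obtain ⟨h1, hh⟩ := energy_eq_ofReal hx h0
  obtain ⟨h, rfl⟩ : ∃ h : ℝ, q = h := ⟨_, h1⟩
  rw [Complex.ofReal_re] at hh
  have e : (V.cutoff k + V.L 0 * V.cutoff k) x = ((cutoffProfile k h * (1 + h) : ℝ) : ℂ) • x := by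
    rw [LinearMap.add_apply, Module.End.mul_apply, V.cutoff_apply k hx, map_smul,
      L_zero_apply hx, smul_smul, ← add_smul]
    congr 1
    push_cast [Complex.ofReal_re]
    ring
  rw [e, norm_smul, Complex.norm_real, Real.norm_of_nonneg
    (mul_nonneg (cutoffProfile_nonneg _ _) (by positivity)), Module.End.one_apply]
  refine mul_le_mul_of_nonneg_right ?_ (norm_nonneg _)
  rcases le_or_gt ((k : ℝ) + 1) h with hk | hk
  · rw [cutoffProfile_eq_zero k hk, zero_mul]
    positivity
  · calc cutoffProfile k h * (1 + h) ≤ 1 * (1 + h) := by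
          gcongr
          exact cutoffProfile_le_one k hh
      _ ≤ k + 2 := by linarith

theorem tendsto_cutoff (x : V.domain) :
    Filter.Tendsto (fun k => V.cutoff k x) Filter.atTop (𝓝 x) := by
  induction x using V.energySpace_induction with
  | zero => simp
  | add x y hx hy => simpa using hx.add hy
  | mem q x hx =>
    simp_rw [V.cutoff_apply _ hx]
    have h := (Complex.continuous_ofReal.tendsto _).comp (tendsto_cutoffProfile q.re)
    simpa using h.smul_const x

/-- The commutators of the Virasoro generators with the cutoffs are uniformly bounded. -/
theorem norm_commutator_cutoff_le (n : ℤ) (k : ℕ) (x : V.domain) :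
    ‖V.L n (V.cutoff k x) - V.cutoff k (V.L n x)‖ ≤
      Real.sqrt (4 + V.c / 6) * |(n : ℝ)| ^ (3 / 2 : ℝ) * ‖x‖ := by
  refine V.norm_le_of_homogeneous (T := V.L n * V.cutoff k - V.cutoff k * V.L n) (S := 1) (s := n)
    (by positivity) (fun q x hx => ?_) (fun q x hx => hx) (fun q x hx => ?_) x
  · exact Submodule.sub_mem _ (V.L_mem_energySpace n (V.cutoff_mem_energySpace k hx))
      (V.cutoff_mem_energySpace k (V.L_mem_energySpace n hx))
  -- On a vector of fixed energy the commutator is `Lₙ` times the difference of the profile at the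
  -- two energies involved.
  have e : (V.L n * V.cutoff k - V.cutoff k * V.L n) x =
      ((cutoffProfile k q.re - cutoffProfile k (q.re - n) : ℝ) : ℂ) • V.L n x := by
    rw [LinearMap.sub_apply, Module.End.mul_apply, Module.End.mul_apply, V.cutoff_apply k hx,
      map_smul, V.cutoff_apply k (V.L_mem_energySpace n hx), ← sub_smul]
    simp
  rw [e, Module.End.one_apply]
  by_cases hL : V.L n x = 0
  · rw [hL]
    simp only [smul_zero, norm_zero]
    positivity
  have h0 : x ≠ 0 := fun h => hL (by rw [h, map_zero])
  obtain ⟨h1, hh⟩ := energy_eq_ofReal hx h0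
  have hl := (energy_eq_ofReal (V.L_mem_energySpace n hx) hL).2
  obtain ⟨h, rfl⟩ : ∃ h : ℝ, q = h := ⟨_, h1⟩
  simp only [Complex.ofReal_re, Complex.sub_re, Complex.intCast_re] at hh hl ⊢
  have hc := V.c_nonneg hx h0
  have hn0 : n ≠ 0 → (1 : ℝ) ≤ |(n : ℝ)| := fun h => by exact_mod_cast Int.one_le_abs h
  have b := V.norm_sq_L_le n hx
  rw [norm_smul, Complex.norm_real, Real.norm_eq_abs]
  refine le_of_sq_le_sq ?_ (by positivity)
  rw [mul_pow, mul_pow, mul_pow, Real.sq_sqrt (by positivity), abs_rpow_sq]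
  refine (mul_le_mul_of_nonneg_left b (by positivity)).trans ?_
  rw [← mul_assoc]
  refine mul_le_mul_of_nonneg_right ?_ (by positivity)
  rw [← sq_abs (n : ℝ)]
  have hM : max h (h - n) ≤ min h (h - n) + |(n : ℝ)| := by
    rcases le_total 0 (n : ℝ) with hn | hn
    · rw [max_eq_left (by linarith), min_eq_right (by linarith), abs_of_nonneg hn]; linarith
    · rw [max_eq_right (by linarith), min_eq_left (by linarith), abs_of_nonpos hn]; linarith
  have hM0 : 0 ≤ max h (h - n) := le_max_of_le_left hh
  have d1 := abs_cutoffProfile_sub_le k h (h - n)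
  rw [sub_sub_cancel, le_div_iff₀ (by positivity)] at d1
  have d2 : |cutoffProfile k h - cutoffProfile k (h - n)| ≤ 1 := by
    rw [abs_le]
    have := cutoffProfile_nonneg k h
    have := cutoffProfile_nonneg k (h - n)
    have := cutoffProfile_le_one k hh
    have := cutoffProfile_le_one k hl
    constructor <;> linarith
  have d3 : ((k : ℝ) + 1 ≤ min h (h - n)) → |cutoffProfile k h - cutoffProfile k (h - n)| = 0 := by
    intro hk
    rw [cutoffProfile_eq_zero k (hk.trans (min_le_left _ _)),
      cutoffProfile_eq_zero k (hk.trans (min_le_right _ _)), sub_zero, abs_zero]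
  set δ := |cutoffProfile k h - cutoffProfile k (h - n)| with hδ
  set M := max h (h - n)
  set m := |(n : ℝ)| with hm
  have m0 : 0 ≤ m := abs_nonneg _
  have δ0 : 0 ≤ δ := abs_nonneg _
  rcases le_or_gt ((k : ℝ) + 1) (min h (h - n)) with hk | hk
  · rw [d3 hk]
    simp only [ne_eq, OfNat.ofNat_ne_zero, not_false_eq_true, zero_pow, zero_mul]
    positivity
  -- The lower of the two energies is now below `k + 1`, so `M ≤ (k + 1) + m`; the first summand is
  -- absorbed by the Lipschitz bound and the second by `δ ≤ 1`.
  have f1 : δ * M ≤ 2 * m := by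
    calc δ * M ≤ δ * ((k + 1) + m) := by gcongr; linarith
      _ = δ * (k + 1) + δ * m := by ring
      _ ≤ m + 1 * m := by gcongr
      _ = 2 * m := by ring
  -- The central term contains a single factor `M`, so one `δ` is spent on it and the other is
  -- bounded by `1`.
  have f2 : δ * (δ * M) ≤ 1 * (2 * m) := mul_le_mul d2 f1 (by positivity) zero_le_one
  have m1 : m ^ 2 ≤ m ^ 3 := by
    by_cases h : n = 0
    · simp [hm, h]
    · exact pow_le_pow_right₀ (hn0 h) (by norm_num)
  calc δ ^ 2 * (M ^ 2 + M * m ^ 2 * (V.c / 12))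
      = (δ * M) ^ 2 + (δ * (δ * M)) * m ^ 2 * (V.c / 12) := by ring
    _ ≤ (2 * m) ^ 2 + (1 * (2 * m)) * m ^ 2 * (V.c / 12) := by gcongr
    _ = 4 * m ^ 2 + m ^ 3 * (V.c / 6) := by ring
    _ ≤ 4 * m ^ 3 + m ^ 3 * (V.c / 6) := by gcongr
    _ = (4 + V.c / 6) * m ^ 3 := by ring

end VirasoroRep
end

noncomputable section

/-! ### Closures of operators on a dense domain -/

/-- A uniformly Lipschitz family is equicontinuous, so its set of convergence to a continuous limit
is closed. -/
theorem tendsto_of_lipschitz_of_dense {X Y : Type*} [PseudoMetricSpace X] [PseudoMetricSpace Y]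
    {s : Set X} (hs : Dense s) {K : NNReal} {F : ℕ → X → Y} (hF : ∀ k, LipschitzWith K (F k))
    {f : X → Y} (hf : Continuous f)
    (h : ∀ x ∈ s, Filter.Tendsto (fun k => F k x) Filter.atTop (𝓝 (f x))) (x : X) :
    Filter.Tendsto (fun k => F k x) Filter.atTop (𝓝 (f x)) := by
  have hc := (LipschitzWith.uniformEquicontinuous F K hF).equicontinuous.isClosed_setOfPred_tendsto
    (l := Filter.atTop) hf
  exact closure_minimal h hc (hs x)

variable {H : Type*} [NormedAddCommGroup H] [InnerProductSpace ℂ H]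

theorem ContinuousLinearMap.lipschitz_of_norm_le {F : H →L[ℂ] H} {C : ℝ}
    (hF : ∀ x, ‖F x‖ ≤ C * ‖x‖) : LipschitzWith C.toNNReal F := by
  refine LipschitzWith.of_dist_le_mul fun x y => ?_
  rw [dist_eq_norm, dist_eq_norm, ← map_sub]
  exact (hF _).trans (mul_le_mul_of_nonneg_right (Real.le_coe_toNNReal C) (norm_nonneg _))

theorem Submodule.exists_clm_extension [CompleteSpace H] {D : Submodule ℂ H}
    (hD : Dense (D : Set H)) (f : D →ₗ[ℂ] H) {C : ℝ} (hf : ∀ x, ‖f x‖ ≤ C * ‖x‖) :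
    ∃ F : H →L[ℂ] H, (∀ x : D, F x = f x) ∧ ∀ x, ‖F x‖ ≤ C * ‖x‖ := by
  have hd : DenseRange D.subtype := by simpa using! hD.denseRange_val
  exact ⟨f.extendOfNorm D.subtype, LinearMap.extendOfNorm_eq hd ⟨C, hf⟩,
    LinearMap.norm_extendOfNorm_apply_le hd C hf⟩

/-- If `A` and `B` are formal adjoints of each other on the dense subspace `D`, and `D` carries
cutoffs `M k` whose commutators with `A` are uniformly bounded, then the adjoint of `B` is contained
in the closure of `A`. -/
theorem mem_closure_of_cutoffs [CompleteSpace H] {D : Submodule ℂ H} (hD : Dense (D : Set H))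
    {A B : D →ₗ[ℂ] H} (hAB : ∀ x y : D, ⟪A x, (y : H)⟫_ℂ = ⟪(x : H), B y⟫_ℂ)
    {M : ℕ → D →ₗ[ℂ] D} {P : ℕ → H →L[ℂ] H} (hP : ∀ k (x : D), P k x = M k x)
    (hM : ∀ k (x y : D), ⟪(M k x : H), (y : H)⟫_ℂ = ⟪(x : H), (M k y : H)⟫_ℂ)
    (hP1 : ∀ k x, ‖P k x‖ ≤ 1 * ‖x‖)
    (hMt : ∀ x : D, Filter.Tendsto (fun k => (M k x : H)) Filter.atTop (𝓝 x))
    (hAM : ∀ k, ∃ C, ∀ x, ‖A (M k x)‖ ≤ C * ‖x‖)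
    {C : ℝ} (hK : ∀ k x, ‖A (M k x) - P k (A x)‖ ≤ C * ‖x‖)
    (hAMt : ∀ x, Filter.Tendsto (fun k => A (M k x)) Filter.atTop (𝓝 (A x)))
    {y z : H} (hyz : ∀ x : D, ⟪B x, y⟫_ℂ = ⟪(x : H), z⟫_ℂ) :
    (y, z) ∈ closure (Set.range fun x : D => ((x : H), A x)) := by
  have hPt : ∀ v, Filter.Tendsto (fun k => P k v) Filter.atTop (𝓝 v) :=
    tendsto_of_lipschitz_of_dense hD (fun k => ContinuousLinearMap.lipschitz_of_norm_le (hP1 k))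
      continuous_id fun x hx => by simpa [hP _ ⟨x, hx⟩] using hMt ⟨x, hx⟩
  have hBA : ∀ x y : D, ⟪B x, (y : H)⟫_ℂ = ⟪(x : H), A y⟫_ℂ := fun x y => by
    rw [← inner_conj_symm, ← hAB, inner_conj_symm]
  have hPs : ∀ k (u v : H), ⟪P k u, v⟫_ℂ = ⟪u, P k v⟫_ℂ := by
    intro k u v
    refine hD.induction (P := fun u => ⟪P k u, v⟫_ℂ = ⟪u, P k v⟫_ℂ) (fun u hu => ?_)
      (isClosed_eq (by fun_prop) (by fun_prop)) u
    refine hD.induction (P := fun v => ⟪P k u, v⟫_ℂ = ⟪u, P k v⟫_ℂ) (fun v hv => ?_)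
      (isClosed_eq (by fun_prop) (by fun_prop)) v
    have := hM k ⟨u, hu⟩ ⟨v, hv⟩
    rwa [← hP, ← hP] at this
  choose C' hC' using hAM
  -- `Q k` extends `A Mₖ` and `K k` extends `[A, Mₖ]` to the whole space, so that both can be
  -- applied to `y`, which need not lie in `D`.
  choose Q hQ hQ1 using fun k => Submodule.exists_clm_extension hD (A ∘ₗ M k) (hC' k)
  choose K hK0 hK1 using fun k => Submodule.exists_clm_extension hD
    (A ∘ₗ M k - (P k : H →ₗ[ℂ] H) ∘ₗ A) (hK k)
  have hKt : ∀ v, Filter.Tendsto (fun k => K k v) Filter.atTop (𝓝 0) := by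
    refine tendsto_of_lipschitz_of_dense hD
      (fun k => ContinuousLinearMap.lipschitz_of_norm_le (hK1 k)) continuous_const fun x hx => ?_
    have h := (hAMt ⟨x, hx⟩).sub (hPt (A ⟨x, hx⟩))
    rw [sub_self] at h
    exact h.congr fun k => (hK0 k ⟨x, hx⟩).symm
  -- This is `A Mₖ y = Mₖ z + [A, Mₖ] y`, tested weakly against `u` in `D`: all operators are moved
  -- onto `u`, where `hyz` replaces `B` by `z`.
  have hQeq : ∀ k, Q k y = P k z + K k y := by
    intro k
    refine hD.eq_of_inner_right ℂ fun u hu => ?_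
    have e1 : ⟪u, Q k y⟫_ℂ = ⟪P k (B ⟨u, hu⟩), y⟫_ℂ := by
      refine hD.induction (P := fun y => ⟪u, Q k y⟫_ℂ = ⟪P k (B ⟨u, hu⟩), y⟫_ℂ)
        (fun x hx => ?_) (isClosed_eq (by fun_prop) (by fun_prop)) y
      rw [hQ k ⟨x, hx⟩, hPs, hP k ⟨x, hx⟩]
      exact (hBA ⟨u, hu⟩ _).symm
    have e2 : ⟪u, K k y⟫_ℂ = ⟪P k (B ⟨u, hu⟩) - B (M k ⟨u, hu⟩), y⟫_ℂ := by
      refine hD.induction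
        (P := fun y => ⟪u, K k y⟫_ℂ = ⟪P k (B ⟨u, hu⟩) - B (M k ⟨u, hu⟩), y⟫_ℂ)
        (fun x hx => ?_) (isClosed_eq (by fun_prop) (by fun_prop)) y
      rw [hK0 k ⟨x, hx⟩, inner_sub_left, hPs, hP k ⟨x, hx⟩, hBA, hBA _ ⟨x, hx⟩, ← hP, hPs,
        ← inner_sub_right]
      rfl
    rw [inner_add_right, e1, e2, inner_sub_left, hyz, ← hP, hPs k u z]
    ring
  -- For `y` in `D` the pair is the graph point of `Mₖ y`; density and continuity do the rest.
  have hmem : ∀ k, (P k y, Q k y) ∈ closure (Set.range fun x : D => ((x : H), A x)) := by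
    intro k
    refine hD.induction
      (P := fun y => (P k y, Q k y) ∈ closure (Set.range fun x : D => ((x : H), A x)))
      (fun x hx => subset_closure ⟨M k ⟨x, hx⟩, ?_⟩) (isClosed_closure.preimage (by fun_prop)) y
    rw [hP k ⟨x, hx⟩, hQ k ⟨x, hx⟩]
    rfl
  have ht : Filter.Tendsto (fun k => (P k y, Q k y)) Filter.atTop (𝓝 (y, z)) := by
    simp_rw [hQeq]
    have := (hPt y).prodMk_nhds ((hPt z).add (hKt y))
    rwa [add_zero] at this
  exact isClosed_closure.mem_of_tendsto ht (Filter.Eventually.of_forall hmem)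

namespace LinearPMap

theorem adjoint_closure [CompleteSpace H] {T : H →ₗ.[ℂ] H} (hd : Dense (T.domain : Set H))
    (hT : T.IsClosable) : T.closure† = T† := by
  have hd' : Dense (T.closure.domain : Set H) := hd.mono T.le_closure.1
  refine eq_of_eq_graph ?_
  rw [adjoint_graph_eq_graph_adjoint hd, adjoint_graph_eq_graph_adjoint hd',
    ← hT.graph_closure_eq_closure_graph]
  ext ⟨y, z⟩
  simp only [Submodule.mem_adjoint_iff]
  refine ⟨fun h a b hab => h a b (T.graph.le_topologicalClosure hab), fun h a b hab => ?_⟩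
  have hc : _root_.IsClosed {p : H × H | ⟪p.2, y⟫_ℂ - ⟪p.1, z⟫_ℂ = 0} :=
    isClosed_eq (by fun_prop) continuous_const
  exact closure_minimal (fun p hp => h p.1 p.2 hp) hc hab

end LinearPMap

namespace VirasoroRep

variable (V : VirasoroRep H)

/-! ### Series of Virasoro generators -/

/-- The two weights differ by a factor of at most `2` except at `n = 0`, where a single term is
added. -/
theorem summable_weight {a : ℤ → ℂ} (ha : Summable fun n : ℤ => ‖a n‖ * |(n : ℝ)| ^ (3 / 2 : ℝ)) :
    Summable fun n : ℤ => ‖a n‖ * (1 + |(n : ℝ)| ^ (3 / 2 : ℝ)) := by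
  have h0 : Summable fun n : ℤ => if n = 0 then ‖a 0‖ else 0 := (hasSum_ite_eq 0 _).summable
  refine Summable.of_nonneg_of_le (fun n => by positivity) (fun n => ?_) ((ha.mul_left 2).add h0)
  by_cases h : n = 0
  · subst h
    simp
  · have h1 : (1 : ℝ) ≤ |(n : ℝ)| := by exact_mod_cast Int.one_le_abs h
    have h2 := h1.trans (abs_le_rpow n)
    rw [if_neg h]
    nlinarith [norm_nonneg (a n)]

theorem norm_term_le (a : ℤ → ℂ) (x : V.domain) (n : ℤ) : ‖a n • (V.L n x : H)‖ ≤
    ‖a n‖ * (1 + |(n : ℝ)| ^ (3 / 2 : ℝ)) * (Real.sqrt (1 + V.c / 12) * ‖x + V.L 0 x‖) := by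
  rw [norm_smul]
  calc ‖a n‖ * ‖(V.L n x : H)‖ ≤ ‖a n‖ *
        (Real.sqrt (1 + V.c / 12) * (1 + |(n : ℝ)| ^ (3 / 2 : ℝ)) * ‖x + V.L 0 x‖) := by
        gcongr
        exact V.norm_L_le n x
    _ = _ := by ring

section

variable [CompleteSpace H] {a : ℤ → ℂ}
  (ha : Summable fun n : ℤ => ‖a n‖ * (1 + |(n : ℝ)| ^ (3 / 2 : ℝ)))

include ha in
theorem summable_term (x : V.domain) : Summable fun n => a n • (V.L n x : H) :=
  Summable.of_norm_bounded (ha.mul_right _) (V.norm_term_le a x)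

include ha in
theorem mem_series_domain (x : V.domain) : (x : H) ∈ (V.series a).domain :=
  ⟨x.2, V.summable_term ha x⟩

include ha in
theorem series_domain : (V.series a).domain = V.domain :=
  le_antisymm (fun _ h => h.fst) fun x hx => V.mem_series_domain ha ⟨x, hx⟩

/-- The operator `∑ₙ aₙ Lₙ` as a linear map on the domain of the representation. -/
def seriesMap : V.domain →ₗ[ℂ] H :=
  (V.series a).toFun ∘ₗ Submodule.inclusion (V.series_domain ha).ge

theorem seriesMap_apply (x : V.domain) : V.seriesMap ha x = ∑' n, a n • (V.L n x : H) := rfl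

theorem coe_graph_series :
    ((V.series a).graph : Set (H × H)) = Set.range fun x : V.domain => ((x : H), V.seriesMap ha x) := by
  ext ⟨x, w⟩
  simp only [SetLike.mem_coe, LinearPMap.mem_graph_iff, Set.mem_range, Prod.mk.injEq]
  constructor
  · rintro ⟨y, rfl, rfl⟩
    exact ⟨⟨y, y.2.fst⟩, rfl, rfl⟩
  · rintro ⟨y, rfl, rfl⟩
    exact ⟨⟨y, V.mem_series_domain ha y⟩, rfl, rfl⟩

theorem norm_seriesMap_le (x : V.domain) : ‖V.seriesMap ha x‖ ≤
    Real.sqrt (1 + V.c / 12) * (∑' n : ℤ, ‖a n‖ * (1 + |(n : ℝ)| ^ (3 / 2 : ℝ))) *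
      ‖x + V.L 0 x‖ := by
  rw [seriesMap_apply]
  refine (tsum_of_norm_bounded (ha.mul_right _).hasSum (V.norm_term_le a x)).trans_eq ?_
  rw [tsum_mul_right]
  ring

end

/-- The coefficients of the formal adjoint of a series of Virasoro generators. -/
def adjointCoeff (a : ℤ → ℂ) (n : ℤ) : ℂ := conj (a (-n))

theorem summable_adjointCoeff {a : ℤ → ℂ}
    (ha : Summable fun n : ℤ => ‖a n‖ * (1 + |(n : ℝ)| ^ (3 / 2 : ℝ))) :
    Summable fun n : ℤ => ‖adjointCoeff a n‖ * (1 + |(n : ℝ)| ^ (3 / 2 : ℝ)) := by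
  refine ((Equiv.neg ℤ).summable_iff.2 ha).congr fun n => ?_
  simp [adjointCoeff]

/-! ### Formal adjoints and closures of the series -/

section

variable [CompleteSpace H] {a : ℤ → ℂ}
  (ha : Summable fun n : ℤ => ‖a n‖ * (1 + |(n : ℝ)| ^ (3 / 2 : ℝ)))

theorem inner_seriesMap (x y : V.domain) :
    ⟪V.seriesMap ha x, (y : H)⟫_ℂ =
      ⟪(x : H), V.seriesMap (summable_adjointCoeff ha) y⟫_ℂ := by
  have h1 : ⟪V.seriesMap ha x, (y : H)⟫_ℂ = conj (∑' n, a n * ⟪(y : H), V.L n x⟫_ℂ) := by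
    rw [← inner_conj_symm, seriesMap_apply, ← innerSL_apply_apply ℂ,
      (innerSL ℂ (y : H)).map_tsum (V.summable_term ha x)]
    simp
  have h2 : ⟪(x : H), V.seriesMap (summable_adjointCoeff ha) y⟫_ℂ =
      ∑' n, adjointCoeff a n * ⟪(x : H), V.L n y⟫_ℂ := by
    rw [seriesMap_apply, ← innerSL_apply_apply ℂ,
      (innerSL ℂ (x : H)).map_tsum (V.summable_term (summable_adjointCoeff ha) y)]
    simp
  rw [h1, h2, Complex.conj_tsum, ← (Equiv.neg ℤ).tsum_eq]
  refine tsum_congr fun n => ?_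
  rw [map_mul, inner_conj_symm, Equiv.neg_apply, V.unitary, neg_neg]
  rfl

include ha in
theorem series_dense : Dense ((V.series a).domain : Set H) := by
  rw [V.series_domain ha]
  exact V.dense_domain

include ha in
theorem series_le_adjoint : V.series a ≤ (V.series (adjointCoeff a))† := by
  refine LinearPMap.IsFormalAdjoint.le_adjoint (V.series_dense (summable_adjointCoeff ha)) ?_
  intro y x
  have h := V.inner_seriesMap ha ⟨x, x.2.fst⟩ ⟨y, y.2.fst⟩
  rw [← inner_conj_symm, ← inner_conj_symm (y : H)]
  exact congrArg conj h.symm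

include ha in
theorem series_isClosable : (V.series a).IsClosable :=
  LinearPMap.isClosable_iff_exists_closed_extension.2
    ⟨_, LinearPMap.adjoint_isClosed (V.series_dense (summable_adjointCoeff ha)),
      V.series_le_adjoint ha⟩

include ha in
theorem coe_graph_closure_series : ((V.series a).closure.graph : Set (H × H)) =
    closure (Set.range fun x : V.domain => ((x : H), V.seriesMap ha x)) := by
  rw [← (V.series_isClosable ha).graph_closure_eq_closure_graph, Submodule.topologicalClosure_coe,
    V.coe_graph_series ha]

theorem exists_cutoffExt (k : ℕ) : ∃ P : H →L[ℂ] H, (∀ x : V.domain, P x = V.cutoff k x) ∧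
    ∀ x, ‖P x‖ ≤ 1 * ‖x‖ := by
  refine Submodule.exists_clm_extension V.dense_domain (V.domain.subtype ∘ₗ V.cutoff k)
    (C := 1) fun x => ?_
  rw [one_mul]
  exact V.norm_cutoff_le k x

theorem norm_seriesMap_commutator_le {k : ℕ} {P : H →L[ℂ] H}
    (hP : ∀ x : V.domain, P x = V.cutoff k x) (x : V.domain) :
    ‖V.seriesMap ha (V.cutoff k x) - P (V.seriesMap ha x)‖ ≤
      (∑' n : ℤ, ‖a n‖ * (1 + |(n : ℝ)| ^ (3 / 2 : ℝ))) * Real.sqrt (4 + V.c / 6) * ‖x‖ := by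
  have h1 : V.seriesMap ha (V.cutoff k x) - P (V.seriesMap ha x) =
      ∑' n, a n • ((V.L n (V.cutoff k x) - V.cutoff k (V.L n x) : V.domain) : H) := by
    rw [seriesMap_apply, seriesMap_apply, P.map_tsum (V.summable_term ha x),
      ← (V.summable_term ha _).tsum_sub ((V.summable_term ha x).mapL P)]
    refine tsum_congr fun n => ?_
    rw [map_smul, hP, ← smul_sub, Submodule.coe_sub]
  rw [h1]
  refine (tsum_of_norm_bounded (ha.mul_right (Real.sqrt (4 + V.c / 6) * ‖x‖)).hasSum
    fun n => ?_).trans_eq (by rw [tsum_mul_right]; ring)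
  rw [norm_smul, mul_assoc]
  gcongr
  refine (V.norm_commutator_cutoff_le n k x).trans ?_
  calc Real.sqrt (4 + V.c / 6) * |(n : ℝ)| ^ (3 / 2 : ℝ) * ‖x‖
      = |(n : ℝ)| ^ (3 / 2 : ℝ) * (Real.sqrt (4 + V.c / 6) * ‖x‖) := by ring
    _ ≤ _ := by
      gcongr
      linarith

/-- The cutoffs commute with `1 + L₀`, so they converge strongly on the domain even in the graph
norm of `L₀`, which dominates the series. -/
theorem tendsto_seriesMap_cutoff (x : V.domain) :
    Filter.Tendsto (fun k => V.seriesMap ha (V.cutoff k x)) Filter.atTop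
      (𝓝 (V.seriesMap ha x)) := by
  rw [tendsto_iff_norm_sub_tendsto_zero]
  have h1 : Filter.Tendsto (fun k => V.cutoff k (x + V.L 0 x) - (x + V.L 0 x)) Filter.atTop
      (𝓝 0) := by
    have := (V.tendsto_cutoff (x + V.L 0 x)).sub_const (x + V.L 0 x)
    rwa [sub_self] at this
  have h2 := h1.norm.const_mul
    (Real.sqrt (1 + V.c / 12) * (∑' n : ℤ, ‖a n‖ * (1 + |(n : ℝ)| ^ (3 / 2 : ℝ))))
  rw [norm_zero, mul_zero] at h2
  refine squeeze_zero (fun k => norm_nonneg _) (fun k => ?_) h2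
  rw [← map_sub]
  refine (V.norm_seriesMap_le ha _).trans_eq ?_
  congr 2
  rw [map_sub, map_add, V.cutoff_L_zero]
  abel

include ha in
/-- The closure of a series of Virasoro generators is the adjoint of its formal adjoint. -/
theorem closure_series : (V.series a).closure = (V.series (adjointCoeff a))† := by
  have hb := summable_adjointCoeff ha
  refine LinearPMap.eq_of_eq_graph (le_antisymm ?_ ?_)
  · rw [← (V.series_isClosable ha).graph_closure_eq_closure_graph]
    exact Submodule.topologicalClosure_minimal _
      (LinearPMap.le_graph_of_le (V.series_le_adjoint ha))
      (LinearPMap.adjoint_isClosed (V.series_dense hb))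
  -- The substantial inclusion: the cutoffs approximate each point of the adjoint's graph by points
  -- of the graph of the series.
  · rintro ⟨y, z⟩ h
    rw [LinearPMap.adjoint_graph_eq_graph_adjoint (V.series_dense hb),
      Submodule.mem_adjoint_iff] at h
    rw [← SetLike.mem_coe, V.coe_graph_closure_series ha]
    choose P hP hP1 using V.exists_cutoffExt
    refine mem_closure_of_cutoffs V.dense_domain (V.inner_seriesMap ha) hP
      (fun k x y => V.inner_cutoff k x y) hP1
      (fun x => (continuous_subtype_val.tendsto x).comp (V.tendsto_cutoff x)) (fun k => ?_)
      (fun k x => V.norm_seriesMap_commutator_le ha (hP k) x) (V.tendsto_seriesMap_cutoff ha)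
      fun x => ?_
    · refine ⟨Real.sqrt (1 + V.c / 12) * (∑' n : ℤ, ‖a n‖ * (1 + |(n : ℝ)| ^ (3 / 2 : ℝ))) *
        (k + 2), fun x => (V.norm_seriesMap_le ha _).trans ?_⟩
      rw [mul_assoc _ ((k : ℝ) + 2)]
      refine mul_le_mul_of_nonneg_left (V.norm_cutoff_add_L_zero_le k x) ?_
      exact mul_nonneg (Real.sqrt_nonneg _) (tsum_nonneg fun n => by positivity)
    · refine sub_eq_zero.1 (h x (V.seriesMap hb x) ?_)
      rw [← SetLike.mem_coe, V.coe_graph_series hb]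
      exact ⟨x, rfl⟩

include ha in
theorem closure_series_isSelfAdjoint (hs : ∀ n, a n = conj (a (-n))) :
    IsSelfAdjoint (V.series a).closure := by
  have h : adjointCoeff a = a := funext fun n => (hs n).symm
  rw [LinearPMap.isSelfAdjoint_def,
    LinearPMap.adjoint_closure (V.series_dense ha) (V.series_isClosable ha), V.closure_series ha, h]

include ha in
theorem series_isEssentiallySelfAdjoint (hs : ∀ n, a n = conj (a (-n))) :
    IsEssentiallySelfAdjoint (V.series a) :=
  ⟨V.series_dense ha, V.series_isClosable ha, V.closure_series_isSelfAdjoint ha hs⟩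

end

/-! ### The conformal Hamiltonian -/

theorem summable_single : Summable fun n : ℤ =>
    ‖(Pi.single 0 1 : ℤ → ℂ) n‖ * (1 + |(n : ℝ)| ^ (3 / 2 : ℝ)) :=
  summable_of_ne_finset_zero (s := {0}) fun n hn => by
    rw [Pi.single_eq_of_ne (by simpa using hn), norm_zero, zero_mul]

theorem seriesMap_single [CompleteSpace H] (x : V.domain) :
    V.seriesMap summable_single x = V.L 0 x := by
  rw [seriesMap_apply, tsum_eq_single 0]
  · simp
  · intro n hn
    rw [Pi.single_eq_of_ne hn, zero_smul]

/-- Series of Virasoro generators are bounded relative to the conformal Hamiltonian. -/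
theorem closure_series_bound [CompleteSpace H] {a : ℤ → ℂ}
    (ha : Summable fun n : ℤ => ‖a n‖ * (1 + |(n : ℝ)| ^ (3 / 2 : ℝ)))
    (v : H) (hv : v ∈ V.hamiltonian.domain) :
    ∃ hv' : v ∈ (V.series a).closure.domain, ‖(V.series a).closure ⟨v, hv'⟩‖ ≤
      Real.sqrt (1 + V.c / 12) * (∑' n : ℤ, ‖a n‖ * (1 + |(n : ℝ)| ^ (3 / 2 : ℝ))) *
        ‖v + V.hamiltonian ⟨v, hv⟩‖ := by
  set C := Real.sqrt (1 + V.c / 12) * (∑' n : ℤ, ‖a n‖ * (1 + |(n : ℝ)| ^ (3 / 2 : ℝ))) with hC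
  have h0 : (v, V.hamiltonian ⟨v, hv⟩) ∈ ((V.series (Pi.single 0 1)).closure.graph : Set (H × H)) :=
    V.hamiltonian.mem_graph ⟨v, hv⟩
  rw [V.coe_graph_closure_series summable_single, mem_closure_iff_seq_limit] at h0
  obtain ⟨p, hp, hpt⟩ := h0
  choose x hx using hp
  have hx1 : Filter.Tendsto (fun k => (x k : H)) Filter.atTop (𝓝 v) := by
    refine ((continuous_fst.tendsto _).comp hpt).congr fun k => ?_
    simp [← hx]
  have hx2 : Filter.Tendsto (fun k => (V.L 0 (x k) : H)) Filter.atTop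
      (𝓝 (V.hamiltonian ⟨v, hv⟩)) := by
    refine ((continuous_snd.tendsto _).comp hpt).congr fun k => ?_
    simp [← hx, seriesMap_single]
  have hx3 := hx1.add hx2
  -- The energy bound for differences transfers convergence from the graph of `L₀` to the graph of
  -- the series.
  have hcauchy : CauchySeq fun k => V.seriesMap ha (x k) := by
    have h := hx3.cauchySeq
    rw [cauchySeq_iff_tendsto_dist_atTop_0] at h ⊢
    have h' := h.const_mul C
    rw [mul_zero] at h'
    refine squeeze_zero (fun _ => dist_nonneg) (fun k => ?_) h'
    rw [dist_eq_norm, dist_eq_norm, ← map_sub]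
    refine (V.norm_seriesMap_le ha _).trans_eq ?_
    rw [map_sub]
    exact congrArg (fun u : H => C * ‖u‖) (show (x k.1 : H) - x k.2 +
      ((V.L 0 (x k.1) : H) - V.L 0 (x k.2)) = _ by abel)
  obtain ⟨w, hw⟩ := cauchySeq_tendsto_of_complete hcauchy
  have hg : (v, w) ∈ (V.series a).closure.graph := by
    rw [← SetLike.mem_coe, V.coe_graph_closure_series ha]
    exact isClosed_closure.mem_of_tendsto (hx1.prodMk_nhds hw)
      (Filter.Eventually.of_forall fun k => subset_closure ⟨x k, rfl⟩)
  obtain ⟨⟨v', hv'⟩, rfl, rfl⟩ := (LinearPMap.mem_graph_iff _).1 hg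
  refine ⟨hv', le_of_tendsto_of_tendsto' hw.norm (hx3.norm.const_mul C) fun k => ?_⟩
  exact V.norm_seriesMap_le ha (x k)

end VirasoroRep
end

noncomputable section

variable {H : Type*} [NormedAddCommGroup H] [InnerProductSpace ℂ H]

/-! ### Resolvents of self-adjoint operators -/

section Resolvent

/-- Since `⟪x, w⟫` is real, the imaginary part of `⟪x, w - z x⟫` is `-(Im z) ‖x‖²`; then
Cauchy–Schwarz. -/
theorem LinearPMap.norm_im_mul_le_of_mem_graph [CompleteSpace H] {A : H →ₗ.[ℂ] H}
    (hA : IsSelfAdjoint A) (z : ℂ) {x w : H} (h : (x, w) ∈ A.graph) :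
    |z.im| * ‖x‖ ≤ ‖w - z • x‖ := by
  have h1 : ⟪w, x⟫_ℂ - ⟪x, w⟫_ℂ = 0 := by
    have h' := h
    rw [← LinearPMap.isSelfAdjoint_def.1 hA,
      LinearPMap.adjoint_graph_eq_graph_adjoint hA.dense_domain, Submodule.mem_adjoint_iff] at h'
    exact h' x w h
  have h2 : (⟪x, w⟫_ℂ).im = 0 := by
    rw [← Complex.conj_eq_iff_im, inner_conj_symm]
    exact sub_eq_zero.1 h1
  have h3 : (⟪x, w - z • x⟫_ℂ).im = -(z.im * ‖x‖ ^ 2) := by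
    have h4 : ⟪x, x⟫_ℂ = ((‖x‖ ^ 2 : ℝ) : ℂ) := by
      rw [inner_self_eq_norm_sq_to_K]
      simp
    rw [inner_sub_right, inner_smul_right, h4, Complex.sub_im, h2, Complex.im_mul_ofReal, zero_sub]
  by_cases hx : x = 0
  · simp [hx]
  have hx0 : 0 < ‖x‖ := norm_pos_iff.2 hx
  have h5 : |z.im| * ‖x‖ ^ 2 ≤ ‖x‖ * ‖w - z • x‖ := by
    calc |z.im| * ‖x‖ ^ 2 = |(⟪x, w - z • x⟫_ℂ).im| := by
          rw [h3, abs_neg, abs_mul, abs_of_nonneg (sq_nonneg ‖x‖)]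
      _ ≤ ‖⟪x, w - z • x⟫_ℂ‖ := Complex.abs_im_le_norm _
      _ ≤ _ := norm_inner_le_norm _ _
  refine le_of_mul_le_mul_left ?_ hx0
  linarith

/-- The operator `A - z` as a map on the graph of `A`. -/
def LinearPMap.graphSub (A : H →ₗ.[ℂ] H) (z : ℂ) : A.graph →L[ℂ] H :=
  (ContinuousLinearMap.snd ℂ H H - z • ContinuousLinearMap.fst ℂ H H) ∘L A.graph.subtypeL

/-- `A - z` is bounded below in the graph norm, hence injective with closed range. A vector `y`
orthogonal to the range satisfies `A y = z̄ y` because `A† = A`, and the lower bound at `z̄` forces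
`y = 0`. -/
theorem LinearPMap.graphSub_bijective [CompleteSpace H] {A : H →ₗ.[ℂ] H}
    (hA : IsSelfAdjoint A) {z : ℂ} (hz : z.im ≠ 0) : Function.Bijective (A.graphSub z) := by
  have hz0 : 0 < |z.im| := abs_pos.2 hz
  have hbound : ∀ p : A.graph, ‖p‖ ≤ (1 + (1 + ‖z‖) / |z.im|) * ‖A.graphSub z p‖ := by
    rintro ⟨⟨x, w⟩, h⟩
    have h1 := norm_im_mul_le_of_mem_graph hA z h
    change ‖(x, w)‖ ≤ (1 + (1 + ‖z‖) / |z.im|) * ‖w - z • x‖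
    have h2 : ‖x‖ ≤ ‖w - z • x‖ / |z.im| := by
      rw [le_div_iff₀ hz0]
      linarith
    have h3 : ‖w‖ ≤ ‖w - z • x‖ + ‖z‖ * ‖x‖ := by
      rw [← norm_smul]
      simpa using norm_add_le (w - z • x) (z • x)
    have e : (1 + (1 + ‖z‖) / |z.im|) * ‖w - z • x‖ =
        ‖w - z • x‖ + ‖w - z • x‖ / |z.im| + ‖z‖ * (‖w - z • x‖ / |z.im|) := by ring
    have h4 := mul_le_mul_of_nonneg_left h2 (norm_nonneg z)
    have h5 := (norm_nonneg x).trans h2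
    have h6 := mul_nonneg (norm_nonneg z) h5
    rw [e]
    refine max_le ?_ ?_
    · change ‖x‖ ≤ _
      linarith [norm_nonneg (w - z • x)]
    · change ‖w‖ ≤ _
      linarith
  have hanti : AntilipschitzWith (1 + (1 + ‖z‖) / |z.im|).toNNReal (A.graphSub z) := by
    refine ContinuousLinearMap.antilipschitz_of_bound _ fun p => ?_
    rw [Real.coe_toNNReal _ (by positivity)]
    exact hbound p
  refine ⟨hanti.injective, ?_⟩
  have : CompleteSpace A.graph := (hA.isClosed : _root_.IsClosed (A.graph : Set (H × H))).completeSpace_coe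
  have hcl : _root_.IsClosed (Set.range (A.graphSub z)) :=
    hanti.isClosed_range (A.graphSub z).uniformContinuous
  have hrange : (LinearMap.range (A.graphSub z : A.graph →ₗ[ℂ] H)) = ⊤ := by
    have : (LinearMap.range (A.graphSub z : A.graph →ₗ[ℂ] H)).topologicalClosure =
        LinearMap.range (A.graphSub z : A.graph →ₗ[ℂ] H) :=
      _root_.IsClosed.submodule_topologicalClosure_eq hcl
    rw [← this, Submodule.topologicalClosure_eq_top_iff, Submodule.eq_bot_iff]
    intro y hy
    have hmem : (y, conj z • y) ∈ A.graph := by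
      rw [← LinearPMap.isSelfAdjoint_def.1 hA,
        LinearPMap.adjoint_graph_eq_graph_adjoint hA.dense_domain, Submodule.mem_adjoint_iff]
      intro x w hxw
      have h : ⟪w - z • x, y⟫_ℂ = 0 := hy _ ⟨⟨(x, w), hxw⟩, rfl⟩
      rw [inner_sub_left, inner_smul_left] at h
      rwa [inner_smul_right]
    have h := norm_im_mul_le_of_mem_graph hA (conj z) hmem
    rw [sub_self, norm_zero, Complex.conj_im, abs_neg] at h
    exact norm_le_zero_iff.1 (nonpos_of_mul_nonpos_right h hz0)
  exact LinearMap.range_eq_top.1 hrange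

theorem LinearPMap.exists_resolvent [CompleteSpace H] {A : H →ₗ.[ℂ] H}
    (hA : IsSelfAdjoint A) {z : ℂ} (hz : z.im ≠ 0) :
    ∃ R : H →L[ℂ] H, IsResolventAt A z R ∧ ∀ v, ‖R v‖ ≤ |z.im|⁻¹ * ‖v‖ := by
  let e := LinearEquiv.ofBijective (A.graphSub z : A.graph →ₗ[ℂ] H) (graphSub_bijective hA hz)
  let R₀ : H →ₗ[ℂ] H := LinearMap.fst ℂ H H ∘ₗ A.graph.subtype ∘ₗ e.symm
  have he : ∀ v, (e.symm v).1.2 - z • R₀ v = v := fun v => e.apply_symm_apply v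
  have hmem : ∀ v, (R₀ v, v + z • R₀ v) ∈ A.graph := by
    intro v
    have h := (e.symm v).2
    rwa [show (e.symm v).1 = (R₀ v, v + z • R₀ v) from
      Prod.ext rfl (sub_eq_iff_eq_add.1 (he v))] at h
  have hR : ∀ v, ‖R₀ v‖ ≤ |z.im|⁻¹ * ‖v‖ := by
    intro v
    have h := norm_im_mul_le_of_mem_graph hA z (hmem v)
    rw [add_sub_cancel_right] at h
    rwa [le_inv_mul_iff₀ (abs_pos.2 hz)]
  refine ⟨R₀.mkContinuous _ hR, ⟨hmem, fun x => ?_⟩, hR⟩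
  have h : e.symm (A x - z • (x : H)) = ⟨(x, A x), A.mem_graph x⟩ :=
    (LinearEquiv.symm_apply_eq _).2 rfl
  change (e.symm (A x - z • (x : H))).1.1 = x
  rw [h]

theorem IsResolventAt.apply_sub {A : H →ₗ.[ℂ] H} {z : ℂ} {R : H →L[ℂ] H}
    (hR : IsResolventAt A z R) {x w : H} (h : (x, w) ∈ A.graph) : R (w - z • x) = x := by
  obtain ⟨y, rfl, rfl⟩ := (LinearPMap.mem_graph_iff _).1 h
  exact hR.2 y

/-- Convergence on a common core implies convergence in the strong resolvent sense. -/
theorem strongResolventTendsto_of_core [CompleteSpace H] {A : ℕ → H →ₗ.[ℂ] H} {B : H →ₗ.[ℂ] H}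
    (hA : ∀ k, IsSelfAdjoint (A k)) (hB : IsSelfAdjoint B) {G : Set (H × H)}
    (hG : (B.graph : Set (H × H)) = closure G)
    (hGA : ∀ p ∈ G, ∃ w : ℕ → H, (∀ k, (p.1, w k) ∈ (A k).graph) ∧
      Filter.Tendsto w Filter.atTop (𝓝 p.2)) :
    StrongResolventTendsto A B := by
  intro z hz
  choose R hR hR1 using fun k => LinearPMap.exists_resolvent (hA k) hz
  obtain ⟨S, hS, -⟩ := LinearPMap.exists_resolvent hB hz
  refine ⟨R, S, hR, hS, ?_⟩
  have hcont : Continuous fun p : H × H => p.2 - z • p.1 := by fun_prop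
  -- `B - z` is onto and `G` is dense in its graph, so it suffices to test the resolvents on `(B -
  -- z)G`.
  have hdense : Dense ((fun p : H × H => p.2 - z • p.1) '' G) := by
    intro v
    have h1 : (S v, v + z • S v) ∈ closure G := by
      rw [← hG]
      exact hS.1 v
    have h2 := image_closure_subset_closure_image hcont ⟨_, h1, rfl⟩
    simpa using h2
  refine tendsto_of_lipschitz_of_dense hdense
    (fun k => ContinuousLinearMap.lipschitz_of_norm_le (hR1 k)) S.continuous ?_
  rintro _ ⟨⟨x, w⟩, hp, rfl⟩
  obtain ⟨u, hu, hut⟩ := hGA _ hp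
  have hxw : (x, w) ∈ B.graph := by
    rw [← SetLike.mem_coe, hG]
    exact subset_closure hp
  simp only [hS.apply_sub hxw] at hu hut ⊢
  have h0 : Filter.Tendsto (fun k => |z.im|⁻¹ * ‖w - u k‖) Filter.atTop (𝓝 0) := by
    have := ((tendsto_const_nhds (x := w)).sub hut).norm.const_mul |z.im|⁻¹
    rwa [sub_self, norm_zero, mul_zero] at this
  rw [tendsto_iff_norm_sub_tendsto_zero]
  refine squeeze_zero (fun _ => norm_nonneg _) (fun k => ?_) h0
  -- Here `x = R k (u k - z x)`, so the error is the resolvent applied to a null sequence.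
  have e : R k (w - z • x) - x = R k (w - u k) := by
    nth_rewrite 2 [← (hR k).apply_sub (hu k)]
    rw [← map_sub]
    congr 1
    abel
  rw [e]
  exact hR1 k _

end Resolvent

/-! ### Unitary groups -/

theorem ContinuousLinearMap.hasDerivAt_comp (L : H →L[ℂ] H) {g : ℝ → H} {g' : H} {s : ℝ}
    (hg : HasDerivAt g g' s) : HasDerivAt (fun r => L (g r)) (L g') s :=
  (L.restrictScalars ℝ).hasFDerivAt.comp_hasDerivAt s hg

namespace IsUnitaryGroup

variable {W : ℝ → H ≃ₗᵢ[ℂ] H} {A : H →ₗ.[ℂ] H} (hW : IsUnitaryGroup W A)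
include hW

theorem add_apply (s t : ℝ) (v : H) : W (s + t) v = W s (W t v) := by
  rw [hW.map_add]
  rfl

theorem mem_graph (t : ℝ) {v w : H} (h : (v, w) ∈ A.graph) : (W t v, W t w) ∈ A.graph := by
  rw [hW.generator] at h ⊢
  have h1 := ((W t).toContinuousLinearEquiv : H →L[ℂ] H).hasDerivAt_comp h
  have h2 : (fun s => W s (W t v)) = fun s => W t (W s v) := by
    funext s
    rw [← hW.add_apply, ← hW.add_apply, add_comm]
  rw [h2, ← map_smul]
  exact h1

theorem hasDerivAt {v w : H} (h : (v, w) ∈ A.graph) (t : ℝ) :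
    HasDerivAt (fun s => W s v) (Complex.I • W t w) t := by
  have h1 := (hW.generator _ _).1 (hW.mem_graph t h)
  have h2 : (fun s => W s v) = fun s => W (s - t) (W t v) := by
    funext s
    rw [← hW.add_apply, sub_add_cancel]
  have h3 : HasDerivAt (fun s => W s (W t v)) (Complex.I • W t w) (t - t) := by rwa [sub_self]
  rw [h2]
  exact h3.comp_sub_const t t

/-- The product rule for a unitary group applied to a differentiable curve. -/
theorem hasDerivAt_sub_apply {g : ℝ → H} {g' w : H} {s : ℝ} (a : ℝ) (hg : HasDerivAt g g' s)
    (h : (g s, w) ∈ A.graph) :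
    HasDerivAt (fun r => W (a - r) (g r)) (W (a - s) (g' - Complex.I • w)) s := by
  have h1 : HasDerivAt (fun r => W (a - r) (g s)) (-(Complex.I • W (a - s) w)) s :=
    (hW.hasDerivAt h (a - s)).comp_const_sub a s
  rw [hasDerivAt_iff_tendsto_slope] at h1 hg ⊢
  -- The operator varies with `r` together with its argument; being isometric, it does not enlarge
  -- the error `slope g s r - g'`.
  have h2 : Filter.Tendsto (fun r => W (a - r) (slope g s r)) (𝓝[≠] s) (𝓝 (W (a - s) g')) := by
    have h3 : Filter.Tendsto (fun r => W (a - r) g') (𝓝[≠] s) (𝓝 (W (a - s) g')) :=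
      (((hW.continuous g').comp (continuous_const.sub continuous_id)).tendsto s).mono_left
        nhdsWithin_le_nhds
    have h4 : Filter.Tendsto (fun r => W (a - r) (slope g s r - g')) (𝓝[≠] s) (𝓝 0) := by
      rw [tendsto_zero_iff_norm_tendsto_zero]
      simp only [LinearIsometryEquiv.norm_map]
      exact tendsto_iff_norm_sub_tendsto_zero.1 hg
    simpa using h3.add h4
  have h5 := h2.add h1
  rw [map_sub, map_smul, sub_eq_add_neg]
  refine h5.congr fun r => ?_
  have e : ∀ u, W (a - r) ((r - s)⁻¹ • u) = (r - s)⁻¹ • W (a - r) u := fun u =>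
    (W (a - r)).toLinearEquiv.toLinearMap.map_smul_of_tower _ u
  rw [slope_def_module, slope_def_module, slope_def_module, e, ← smul_add, map_sub]
  congr 1
  abel

theorem resolvent_comm {z : ℂ} {S : H →L[ℂ] H} (hS : IsResolventAt A z S) (t : ℝ) (v : H) :
    S (W t v) = W t (S v) := by
  have h := hS.apply_sub (hW.mem_graph t (hS.1 v))
  rwa [← (W t).map_smul, ← (W t).map_sub, add_sub_cancel_right] at h

end IsUnitaryGroup

theorem tendsto_integral_norm_sub {R : ℕ → H →L[ℂ] H} {S : H →L[ℂ] H} {C : ℝ}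
    (hR : ∀ k v, ‖R k v‖ ≤ C * ‖v‖) (hRS : ∀ v, Filter.Tendsto (fun k => R k v) Filter.atTop (𝓝 (S v)))
    {c : ℝ → H} (hc : Continuous c) {b : ℝ} (hb : ∀ s, ‖c s‖ ≤ b) :
    Filter.Tendsto (fun k => ∫ s in (0 : ℝ)..1, ‖R k (c s) - S (c s)‖) Filter.atTop (𝓝 0) := by
  have h := intervalIntegral.tendsto_integral_filter_of_dominated_convergence
    (μ := MeasureTheory.volume) (a := 0) (b := 1) (l := Filter.atTop)
    (F := fun k s => ‖R k (c s) - S (c s)‖) (f := fun _ => (0 : ℝ))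
    (fun _ => (|C| + ‖S‖) * b)
    (Filter.Eventually.of_forall fun k => Continuous.aestronglyMeasurable (by fun_prop))
    (Filter.Eventually.of_forall fun k => Filter.Eventually.of_forall fun s _ => ?_)
    intervalIntegrable_const
    (Filter.Eventually.of_forall fun s _ => tendsto_iff_norm_sub_tendsto_zero.1 (hRS (c s)))
  · simpa using h
  · rw [norm_norm]
    calc ‖R k (c s) - S (c s)‖ ≤ ‖R k (c s)‖ + ‖S (c s)‖ := norm_sub_le _ _
      _ ≤ |C| * ‖c s‖ + ‖S‖ * ‖c s‖ := by
        gcongr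
        · exact (hR k _).trans (by gcongr; exact le_abs_self C)
        · exact S.le_opNorm _
      _ = (|C| + ‖S‖) * ‖c s‖ := by ring
      _ ≤ _ := by
        gcongr
        exact hb s

/-- Trotter's theorem: strong resolvent convergence implies strong convergence of the unitary
groups. -/
theorem StrongResolventTendsto.tendsto_unitary [CompleteSpace H] {A : ℕ → H →ₗ.[ℂ] H}
    {B : H →ₗ.[ℂ] H} (hAB : StrongResolventTendsto A B) (hA : ∀ k, IsSelfAdjoint (A k))
    (hB : Dense (B.domain : Set H)) {W : ℕ → ℝ → H ≃ₗᵢ[ℂ] H} {W' : ℝ → H ≃ₗᵢ[ℂ] H}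
    (hW : ∀ k, IsUnitaryGroup (W k) (A k)) (hW' : IsUnitaryGroup W' B) (v : H) :
    Filter.Tendsto (fun k => W k 1 v) Filter.atTop (𝓝 (W' 1 v)) := by
  obtain ⟨R, S, hR, hS, hRS⟩ := hAB Complex.I (by simp)
  have hR1 : ∀ k v, ‖R k v‖ ≤ 1 * ‖v‖ := by
    intro k v
    have h := LinearPMap.norm_im_mul_le_of_mem_graph (hA k) Complex.I ((hR k).1 v)
    rw [add_sub_cancel_right] at h
    simpa using h
  have hSd : DenseRange S := by
    refine hB.mono fun x hx => ⟨B ⟨x, hx⟩ - Complex.I • x, hS.2 ⟨x, hx⟩⟩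
  -- One resolvent puts `S v` in the domain of `B`, making its orbit differentiable; the other is
  -- compared with `R k`, which maps into the domain of `A k`.
  have hdense : Dense (Set.range fun u => S (S u)) := hSd.comp hSd S.continuous
  refine tendsto_of_lipschitz_of_dense hdense (fun k => (W k 1).lipschitz) (W' 1).continuous ?_ v
  rintro _ ⟨v, rfl⟩
  have key : ∀ k, ‖R k (W' 1 (S v)) - W k 1 (R k (S v))‖ ≤
      ∫ s in (0 : ℝ)..1, ‖R k (W' s v) - S (W' s v)‖ := by
    intro k
    -- Duhamel interpolation between the two groups. In its derivative the unbounded generators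
    -- cancel, leaving only the difference `R k - S` of the resolvents at `i` along the orbit of
    -- `v`.
    set f : ℝ → H := fun s => W k (1 - s) (R k (W' s (S v))) with hf
    set D : ℝ → H := fun s => Complex.I • W k (1 - s) (R k (W' s v) - S (W' s v)) with hD
    have hderiv : ∀ s, HasDerivAt f (D s) s := by
      intro s
      have h1 := (R k).hasDerivAt_comp (hW'.hasDerivAt (hS.1 v) s)
      have h2 := (hW k).hasDerivAt_sub_apply 1 h1 ((hR k).1 (W' s (S v)))
      refine h2.congr_deriv ?_
      rw [hD]
      simp only [map_smul, ← smul_sub]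
      congr 2
      rw [map_add, map_smul, map_add, map_smul, hW'.resolvent_comm hS]
      abel
    have h1 : f 1 - f 0 = R k (W' 1 (S v)) - W k 1 (R k (S v)) := by
      simp [hf, (hW k).map_zero, hW'.map_zero]
    rw [← h1]
    have hnorm : ∀ s, ‖D s‖ = ‖R k (W' s v) - S (W' s v)‖ := fun s => by
      rw [hD, norm_smul, Complex.norm_I, one_mul, LinearIsometryEquiv.norm_map]
    have hci : Continuous fun s => ‖R k (W' s v) - S (W' s v)‖ := by
      have := hW'.continuous v
      fun_prop
    refine norm_sub_le_integral_of_norm_deriv_le_of_le zero_le_one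
      (fun s _ => (hderiv s).continuousAt.continuousWithinAt)
      (fun s _ => (hderiv s).differentiableAt.differentiableWithinAt)
      (Filter.Eventually.of_forall fun s _ => ?_) (hci.intervalIntegrable _ _)
    rw [(hderiv s).deriv, hnorm]
  have h1 := tendsto_integral_norm_sub hR1 hRS (hW'.continuous v) (b := ‖v‖) (fun s => by simp)
  have h2 := tendsto_iff_norm_sub_tendsto_zero.1 (hRS (S v))
  have h3 := tendsto_iff_norm_sub_tendsto_zero.1 (hRS (W' 1 (S v)))
  have h4 := (h2.add h1).add h3
  simp only [add_zero] at h4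
  rw [tendsto_iff_norm_sub_tendsto_zero]
  refine squeeze_zero (fun _ => norm_nonneg _) (fun k => ?_) h4
  have e : W k 1 (S (S v)) - W' 1 (S (S v)) = -(W k 1 (R k (S v) - S (S v))) -
      (R k (W' 1 (S v)) - W k 1 (R k (S v))) + (R k (W' 1 (S v)) - S (W' 1 (S v))) := by
    rw [map_sub, hW'.resolvent_comm hS]
    abel
  rw [e]
  refine (norm_add_le _ _).trans (add_le_add_left ((norm_sub_le _ _).trans ?_) _)
  rw [norm_neg, LinearIsometryEquiv.norm_map]
  exact add_le_add_right (key k) _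

end

noncomputable section

/-! ### Fourier coefficients -/

theorem circleCoeff_eq_conj (f : C(Circle, ℝ)) (n : ℤ) :
    circleCoeff f n = conj (circleCoeff f (-n)) := by
  rw [circleCoeff, circleCoeff, map_mul, ← intervalIntegral.intervalIntegral_conj]
  congr 1
  · simp [map_ofNat]
  · refine intervalIntegral.integral_congr fun θ _ => ?_
    simp only [map_mul, Complex.conj_ofReal, ← Complex.exp_conj, map_neg, Complex.conj_I]
    simp

theorem circleCoeff_sub (f g : C(Circle, ℝ)) (n : ℤ) :
    circleCoeff (f - g) n = circleCoeff f n - circleCoeff g n := by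
  have h : ∀ f : C(Circle, ℝ), IntervalIntegrable
      (fun θ : ℝ => (f (Circle.exp θ) : ℂ) * Complex.exp (-(Complex.I * n * θ)))
      MeasureTheory.volume 0 (2 * Real.pi) := fun f =>
    Continuous.intervalIntegrable (by fun_prop) _ _
  rw [circleCoeff, circleCoeff, circleCoeff, ← mul_sub,
    ← intervalIntegral.integral_sub (h f) (h g)]
  simp [sub_mul]

theorem toReal_norm32 (f : C(Circle, ℝ)) :
    (norm32 f).toReal = ∑' n : ℤ, ‖circleCoeff f n‖ * (1 + |(n : ℝ)| ^ (3 / 2 : ℝ)) := by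
  rw [norm32, ENNReal.tsum_toReal_eq fun _ => ENNReal.ofReal_ne_top]
  exact tsum_congr fun n => ENNReal.toReal_ofReal (by positivity)

theorem summable_of_norm32_lt_top {f : C(Circle, ℝ)} (hf : norm32 f < ∞) :
    Summable fun n : ℤ => ‖circleCoeff f n‖ * (1 + |(n : ℝ)| ^ (3 / 2 : ℝ)) :=
  (ENNReal.summable_toReal hf.ne).congr fun n => ENNReal.toReal_ofReal (by positivity)

/-! ### Self-adjointness and continuity of the stress-energy tensor -/

namespace VirasoroRep

variable {H : Type*} [NormedAddCommGroup H] [InnerProductSpace ℂ H] [CompleteSpace H]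
  (V : VirasoroRep H)

theorem stressTensor_isSelfAdjoint {f : C(Circle, ℝ)} (hf : norm32 f < ∞) :
    IsSelfAdjoint (V.stressTensor f) :=
  V.closure_series_isSelfAdjoint (summable_of_norm32_lt_top hf) (circleCoeff_eq_conj f)

theorem seriesMap_mem_graph_stressTensor {f : C(Circle, ℝ)} (hf : norm32 f < ∞) (x : V.domain) :
    ((x : H), V.seriesMap (summable_of_norm32_lt_top hf) x) ∈ (V.stressTensor f).graph := by
  rw [← SetLike.mem_coe, stressTensor,
    V.coe_graph_closure_series (summable_of_norm32_lt_top hf)]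
  exact subset_closure ⟨x, rfl⟩

theorem norm_seriesMap_sub_le {f g : C(Circle, ℝ)} (hf : norm32 f < ∞) (hg : norm32 g < ∞)
    (x : V.domain) :
    ‖V.seriesMap (summable_of_norm32_lt_top hf) x - V.seriesMap (summable_of_norm32_lt_top hg) x‖ ≤
      Real.sqrt (1 + V.c / 12) * (norm32 (f - g)).toReal * ‖x + V.L 0 x‖ := by
  have sf := summable_of_norm32_lt_top hf
  have sg := summable_of_norm32_lt_top hg
  have hs : Summable fun n : ℤ =>
      ‖circleCoeff (f - g) n‖ * (1 + |(n : ℝ)| ^ (3 / 2 : ℝ)) := by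
    refine Summable.of_nonneg_of_le (fun n => by positivity) (fun n => ?_) (sf.add sg)
    rw [circleCoeff_sub, ← add_mul]
    gcongr
    exact norm_sub_le _ _
  have e : V.seriesMap sf x - V.seriesMap sg x = V.seriesMap hs x := by
    rw [seriesMap_apply, seriesMap_apply, seriesMap_apply,
      ← (V.summable_term sf x).tsum_sub (V.summable_term sg x)]
    exact tsum_congr fun n => by rw [circleCoeff_sub, sub_smul]
  rw [e, toReal_norm32]
  exact V.norm_seriesMap_le hs x

theorem stressTensor_strongResolventTendsto {f : C(Circle, ℝ)} {F : ℕ → C(Circle, ℝ)}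
    (hf : norm32 f < ∞) (hF : ∀ k, norm32 (F k) < ∞)
    (hFf : Filter.Tendsto (fun k => norm32 (F k - f)) Filter.atTop (𝓝 0)) :
    StrongResolventTendsto (fun k => V.stressTensor (F k)) (V.stressTensor f) := by
  refine strongResolventTendsto_of_core (fun k => V.stressTensor_isSelfAdjoint (hF k))
    (V.stressTensor_isSelfAdjoint hf)
    (V.coe_graph_closure_series (summable_of_norm32_lt_top hf)) ?_
  rintro _ ⟨x, rfl⟩
  refine ⟨fun k => V.seriesMap (summable_of_norm32_lt_top (hF k)) x,
    fun k => V.seriesMap_mem_graph_stressTensor (hF k) x, ?_⟩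
  have h := (((ENNReal.tendsto_toReal ENNReal.zero_ne_top).comp hFf).const_mul
    (Real.sqrt (1 + V.c / 12))).mul_const ‖x + V.L 0 x‖
  rw [ENNReal.toReal_zero, mul_zero, zero_mul] at h
  rw [tendsto_iff_norm_sub_tendsto_zero]
  exact squeeze_zero (fun _ => norm_nonneg _) (fun k => V.norm_seriesMap_sub_le (hF k) hf x) h

end VirasoroRep

end

theorem mainTheorem5 {H : Type*} [NormedAddCommGroup H] [InnerProductSpace ℂ H] [CompleteSpace H]
    (U : DiffPlus →* ProjUnitary H) (hU : IsPositiveEnergy U)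
    (V : VirasoroRep H) (hV : V.IsAssociatedTo U) :
    (∀ a : ℤ → ℂ, Summable (fun n : ℤ => ‖a n‖ * |(n : ℝ)| ^ (3 / 2 : ℝ)) →
      (V.series a).domain = V.domain ∧
      (V.series fun n => conj (a (-n))).domain = V.domain ∧
      (V.series a).IsClosable ∧
      (V.series a).closure = (V.series fun n => conj (a (-n)))† ∧
      ((∀ n, a n = conj (a (-n))) → IsEssentiallySelfAdjoint (V.series a))) ∧
    (∀ f : C(Circle, ℝ), norm32 f < ∞ →
      (V.series (circleCoeff f)).domain = V.domain ∧
      IsEssentiallySelfAdjoint (V.series (circleCoeff f)) ∧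
      ∀ (v : H) (hv : v ∈ V.hamiltonian.domain), ∃ hv' : v ∈ (V.stressTensor f).domain,
        ‖V.stressTensor f ⟨v, hv'⟩‖ ≤
          Real.sqrt (1 + V.c / 12) * (norm32 f).toReal * ‖v + V.hamiltonian ⟨v, hv⟩‖) ∧
    (∀ (f : C(Circle, ℝ)) (F : ℕ → C(Circle, ℝ)), norm32 f < ∞ → (∀ k, norm32 (F k) < ∞) →
      Filter.Tendsto (fun k => norm32 (F k - f)) Filter.atTop (𝓝 0) →
      StrongResolventTendsto (fun k => V.stressTensor (F k)) (V.stressTensor f) ∧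
      ∀ (W : ℕ → ℝ → H ≃ₗᵢ[ℂ] H) (W' : ℝ → H ≃ₗᵢ[ℂ] H),
        (∀ k, IsUnitaryGroup (W k) (V.stressTensor (F k))) →
        IsUnitaryGroup W' (V.stressTensor f) →
        ∀ v, Filter.Tendsto (fun k => W k 1 v) Filter.atTop (𝓝 (W' 1 v))) := by
  refine ⟨fun a ha => ?_, fun f hf => ?_, fun f F hf hF hFf => ?_⟩
  · have hs := VirasoroRep.summable_weight ha
    exact ⟨V.series_domain hs, V.series_domain (VirasoroRep.summable_adjointCoeff hs),
      V.series_isClosable hs, V.closure_series hs, V.series_isEssentiallySelfAdjoint hs⟩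
  · have hs := summable_of_norm32_lt_top hf
    refine ⟨V.series_domain hs, V.series_isEssentiallySelfAdjoint hs (circleCoeff_eq_conj f),
      fun v hv => ?_⟩
    rw [toReal_norm32]
    exact V.closure_series_bound hs v hv
  · have h := V.stressTensor_strongResolventTendsto hf hF hFf
    exact ⟨h, fun W W' hW hW' => h.tendsto_unitary (fun k => V.stressTensor_isSelfAdjoint (hF k))
      (V.stressTensor_isSelfAdjoint hf).dense_domain hW hW'⟩
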